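/- A directed plane multigraph $G$ is a finite directed multigraph (loops and parallel edges allowed, connectedness not required) together with a drawing in the plane, given combinatorially: for every vertex, the cyclic order of the edge ends around it, together with the faces and their incidences. It is max-degree-3 if every vertex has degree at most $3$, where the degree is the number of incident edge ends. A Hamiltonian cycle of $G$ is a directed cycle (of length at least $1$) that passes through every vertex exactly once. A spanning subgraph of $G$ consists of all the vertices and a subset of the edges of $G$, and inherits the drawing of $G$. An edge is oriented clockwise around a face on its right-hand side and counterclockwise around a face on its left-hand side (the exterior face is treated like every other face). **Lemma.** There is an algorithm (for a random access machine with addition and subtraction) and a polynomial $p$ such that, for every directed max-degree-3 plane multigraph $G$ with $n$ vertices and $m$ edges, the algorithm halts on input $G$ after at most $p(n+m)$ steps and either 1. correctly reports that $G$ has no Hamiltonian cycle, or 2. outputs a spanning subgraph $H$ of $G$ such that every Hamiltonian cycle of $G$ is contained in $H$, and such that the faces of $H$ can be colored blue, white and yellow so that * the faces on the two sides of each edge of $H$ have different colors, * every edge of $H$ on the boundary of a blue face is oriented clockwise around that face, * every edge of $H$ on the boundary of a white face is oriented counterclockwise around that face, * along each boundary walk of a yellow face, cyclically consecutive edges have opposite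 orientations (clockwise and counterclockwise) around that face. -/

import Mathlib

/-! ## Directed plane multigraphs, as combinatorial embeddings -/

/-- A directed multigraph with vertices `Fin n` and edges `Fin m` (loops and parallel edges are
allowed), together with the combinatorial data of a drawing with faces `Fin f`.

The two ends (darts) of the edge `e` are `(e, true)`, the end at the tail `src e`, and
`(e, false)`, the end at the head `tgt e`. A dart is also read as a traversal of its edge that
starts at that end, so that `(e, true)` runs along the direction of `e` and `(e, false)` runs
against it.
* `rot d` is the next dart after `d` in counterclockwise order around their common vertex;
* `left d` is the face on the left-hand side of `d`;
* `vface v` is a face that has the vertex `v` on its boundary (for an isolated vertex, this is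
  the face in which it lies). -/
structure EmbeddedDigraph (n m f : ℕ) where
  src : Fin m → Fin n
  tgt : Fin m → Fin n
  rot : Equiv.Perm (Fin m × Bool)
  left : Fin m × Bool → Fin f
  vface : Fin n → Fin f

namespace EmbeddedDigraph

variable {n m f : ℕ} (G : EmbeddedDigraph n m f)

/-- The other end of the same edge; the same edge traversed the other way. -/
def rev (d : Fin m × Bool) : Fin m × Bool := (d.1, !d.2)

/-- The vertex at which a dart sits. -/
def vert (d : Fin m × Bool) : Fin n := if d.2 then G.src d.1 else G.tgt d.1

/-- The connected components of the underlying undirected graph. -/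
def Component : Type := Quot fun u v : Fin n => ∃ e, G.src e = u ∧ G.tgt e = v

/-- The vertex `v` lies on the boundary of the face `x`. -/
def Incident (v : Fin n) (x : Fin f) : Prop :=
  G.vface v = x ∨ ∃ d, G.vert d = v ∧ G.left d = x

/-- The bipartite graph of incidences between vertices and faces. -/
def incidenceGraph : SimpleGraph (Fin n ⊕ Fin f) :=
  SimpleGraph.fromRel fun a b => ∃ v x, a = Sum.inl v ∧ b = Sum.inr x ∧ G.Incident v x

/-- The data are those of a drawing in the plane (equivalently, on the sphere; the exterior face
is a face like the others). Connectedness of the graph is not required. The last two conditions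
say that every connected component is drawn with genus zero and that the components are placed
into one another's faces in a tree-like way: a drawing of a graph with connected vertex-face
incidences is plane exactly when Euler's formula for graphs with `c` components,
`V - E + F = 1 + c`, holds. -/
structure IsPlane : Prop where
  /-- The cycles of the rotation are the sets of all darts at a vertex. -/
  rot_cycle : ∀ d d', G.rot.SameCycle d d' ↔ G.vert d = G.vert d'
  /-- The corner between `d` and the next dart `rot d` lies to the left of `d` and to the right
  of `rot d`, and belongs to a single face. -/
  left_rot : ∀ d, G.left (rev (G.rot d)) = G.left d
  /-- If `v` is not isolated, then `vface v` is the face of a corner at `v`. -/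
  vface_corner : ∀ d, ∃ d', G.vert d' = G.vert d ∧ G.left d' = G.vface (G.vert d)
  connected : G.incidenceGraph.Connected
  euler : n + f = m + 1 + Nat.card G.Component

/-- Every vertex has degree at most `k`; a loop contributes two to the degree. -/
def MaxDegreeLE (k : ℕ) : Prop :=
  ∀ v, (Finset.univ.filter fun d => G.vert d = v).card ≤ k

/-- `C` is the edge set of a directed Hamiltonian cycle: a closed directed walk
`w 0, …, w (k - 1)` with at least one edge that passes through every vertex exactly once. -/
def IsHamiltonianCycle (C : Set (Fin m)) : Prop :=
  ∃ k : ℕ, 0 < k ∧ ∃ w : Fin k → Fin m, Set.range w = C ∧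
    Function.Bijective (fun i => G.src (w i)) ∧
    ∀ i, G.tgt (w i) = G.src (w (finRotate k i))

/-! ### The faces of a spanning subgraph

A spanning subgraph is given by its set `S` of edges; it inherits the drawing. -/

/-- The faces of the spanning subgraph with edge set `S`: deleting an edge merges the faces on
its two sides. -/
def SubFace (S : Set (Fin m)) : Type :=
  Quot fun x y : Fin f => ∃ e, e ∉ S ∧ G.left (e, true) = x ∧ G.left (e, false) = y

/-- The face of the spanning subgraph on the left-hand side of a dart. -/
def subLeft (S : Set (Fin m)) (d : Fin m × Bool) : G.SubFace S := Quot.mk _ (G.left d)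

/-- `d'` is the first dart of the spanning subgraph that follows `d` in counterclockwise order
around their vertex (it is `d` itself if there is no other one). -/
def NextAround (S : Set (Fin m)) (d d' : Fin m × Bool) : Prop :=
  d'.1 ∈ S ∧ ∃ k : ℕ, 0 < k ∧ (G.rot ^ k) d = d' ∧
    ∀ j : ℕ, 0 < j → j < k → ((G.rot ^ j) d).1 ∉ S

/-- In the spanning subgraph, the boundary walk that keeps a face on its left traverses `d'`
right after `d`. -/
def NextOnFace (S : Set (Fin m)) (d d' : Fin m × Bool) : Prop :=
  d.1 ∈ S ∧ d'.1 ∈ S ∧ G.NextAround S d' (rev d)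

end EmbeddedDigraph

/-- The colors of the faces. -/
inductive FaceColor
  | blue
  | white
  | yellow

/-- `c` is a proper coloring of the faces of the spanning subgraph with edge set `S`, in which
blue faces are oriented clockwise, white faces counterclockwise, and the edges around a yellow
face alternate between the two directions.

A dart `d` lies on the boundary of the face on its left; its edge is oriented counterclockwise
around that face if `d.2 = true` and clockwise if `d.2 = false`. -/
structure EmbeddedDigraph.IsOrientationColoring {n m f : ℕ} (G : EmbeddedDigraph n m f)
    (S : Set (Fin m)) (c : G.SubFace S → FaceColor) : Prop where
  proper : ∀ e ∈ S, c (G.subLeft S (e, true)) ≠ c (G.subLeft S (e, false))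
  blue_clockwise : ∀ d : Fin m × Bool, d.1 ∈ S →
    c (G.subLeft S d) = FaceColor.blue → d.2 = false
  white_counterclockwise : ∀ d : Fin m × Bool, d.1 ∈ S →
    c (G.subLeft S d) = FaceColor.white → d.2 = true
  yellow_alternating : ∀ d d' : Fin m × Bool, G.NextOnFace S d d' →
    c (G.subLeft S d) = FaceColor.yellow → d'.2 ≠ d.2

/-! ## Random access machines

Structured programs for a random access machine whose memory consists of registers and arrays of
natural numbers. The arithmetic operations are addition and truncated subtraction only, so that
unit cost is polynomially related to the running time of a Turing machine. -/

namespace Ram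

/-- A memory: the register `x` holds `reg x`, the cell `i` of the array `a` holds `arr a i`. -/
structure State where
  reg : ℕ → ℕ
  arr : ℕ → ℕ → ℕ

/-- Expressions: constants, registers, array cells `a[e]`, sums and truncated differences. -/
inductive Expr
  | lit (k : ℕ)
  | reg (x : ℕ)
  | get (a : ℕ) (e : Expr)
  | add (e₁ e₂ : Expr)
  | sub (e₁ e₂ : Expr)

/-- The value of an expression. -/
def Expr.eval (s : State) : Expr → ℕ
  | lit k => k
  | reg x => s.reg x
  | get a e => s.arr a (e.eval s)
  | add e₁ e₂ => e₁.eval s + e₂.eval s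
  | sub e₁ e₂ => e₁.eval s - e₂.eval s

/-- The number of operations in the evaluation of an expression. -/
def Expr.cost : Expr → ℕ
  | lit _ => 1
  | reg _ => 1
  | get _ e => e.cost + 1
  | add e₁ e₂ => e₁.cost + e₂.cost + 1
  | sub e₁ e₂ => e₁.cost + e₂.cost + 1

/-- Programs. -/
inductive Prog
  | skip
  /-- `x := e` -/
  | assign (x : ℕ) (e : Expr)
  /-- `a[i] := e` -/
  | store (a : ℕ) (i e : Expr)
  | seq (P Q : Prog)
  /-- run `P` if `e ≠ 0`, else run `Q` -/
  | cond (e : Expr) (P Q : Prog)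
  /-- while `e ≠ 0`, run `P` -/
  | loop (e : Expr) (P : Prog)

/-- `Runs P s t s'`: the program `P`, started in the memory `s`, halts after `t` steps with the
memory `s'`. -/
inductive Runs : Prog → State → ℕ → State → Prop
  | skip (s : State) : Runs .skip s 1 s
  | assign (s : State) (x : ℕ) (e : Expr) :
      Runs (.assign x e) s (e.cost + 1) ⟨Function.update s.reg x (e.eval s), s.arr⟩
  | store (s : State) (a : ℕ) (i e : Expr) :
      Runs (.store a i e) s (i.cost + e.cost + 1)
        ⟨s.reg, Function.update s.arr a (Function.update (s.arr a) (i.eval s) (e.eval s))⟩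
  | seq {P Q : Prog} {s s' s'' : State} {t t' : ℕ} :
      Runs P s t s' → Runs Q s' t' s'' → Runs (.seq P Q) s (t + t') s''
  | cond_true {e : Expr} {P Q : Prog} {s s' : State} {t : ℕ} :
      e.eval s ≠ 0 → Runs P s t s' → Runs (.cond e P Q) s (e.cost + 1 + t) s'
  | cond_false {e : Expr} {P Q : Prog} {s s' : State} {t : ℕ} :
      e.eval s = 0 → Runs Q s t s' → Runs (.cond e P Q) s (e.cost + 1 + t) s'
  | loop_done {e : Expr} {P : Prog} {s : State} :
      e.eval s = 0 → Runs (.loop e P) s (e.cost + 1) s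
  | loop_step {e : Expr} {P : Prog} {s s' s'' : State} {t t' : ℕ} :
      e.eval s ≠ 0 → Runs P s t s' → Runs (.loop e P) s' t' s'' →
        Runs (.loop e P) s (e.cost + 1 + t + t') s''

/-- The array with entries `g 0, …, g (k - 1)`, padded with zeros. -/
def table {k : ℕ} (g : Fin k → ℕ) (i : ℕ) : ℕ := if h : i < k then g ⟨i, h⟩ else 0

end Ram

namespace EmbeddedDigraph

variable {n m f : ℕ} (G : EmbeddedDigraph n m f)

/-- The number that represents a dart: `(e, true)` is `e` and `(e, false)` is `m + e`. -/
def dartCode (d : Fin m × Bool) : ℕ := if d.2 then (d.1 : ℕ) else m + d.1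

/-- The memory that holds an embedded directed multigraph as the input: the registers
`0`, `1`, `2` hold the numbers of vertices, edges and faces, and the arrays `0`, …, `6` list the
tails, the heads, the rotation at the tails and at the heads, the faces to the left and to the
right of the edges, and the faces at the vertices. Everything else is zero. -/
def input : Ram.State where
  reg
    | 0 => n
    | 1 => m
    | 2 => f
    | _ => 0
  arr
    | 0 => Ram.table fun e => G.src e
    | 1 => Ram.table fun e => G.tgt e
    | 2 => Ram.table fun e => dartCode (G.rot (e, true))
    | 3 => Ram.table fun e => dartCode (G.rot (e, false))
    | 4 => Ram.table fun e => G.left (e, true)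
    | 5 => Ram.table fun e => G.left (e, false)
    | 6 => Ram.table fun v => G.vface v
    | _ => fun _ => 0

/-- The edge set that is returned in the array `7`, as its characteristic function. -/
def outputEdges (m : ℕ) (s : Ram.State) : Set (Fin m) := {e | s.arr 7 e ≠ 0}

end EmbeddedDigraph

/-! The algorithm propagates local necessary conditions. A Hamiltonian cycle ("tour") uses one
outgoing and one incoming dart at each vertex. With degree at most three, a dart off the tour shares
its direction with exactly one tour dart at its vertex, its `partner`. Hence a dart without a
partner is forced, and exactly one edge of a partner pair is used. A further condition comes from
planarity: an edge off the tour has both ends on the same side of it, so the darts following its two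
ends have equal directions (`IsTour.rot_rev_snd`); an edge that violates this is forced. These
deductions are applied until none decides an edge (`Stable`), and the edges proved unusable are
deleted.

Suppose a tour exists. In a stable state every vertex meets either no undecided dart or one partner
pair of them. The undecided edges therefore form a cycle modulo two, and stability along each of
them makes the corners between partners descend to a set of faces: the yellow ones
(`IsTour.exists_yellow`). The remaining faces are white to the left of the tour and blue to its
right. The resulting color can be read off locally at each corner, without knowing the tour
(`cornerColor`, `IsTour.exists_color`).

The program computes these corner colors and tests whether they agree on each face, agree across
deleted edges and differ across kept ones. Failure refutes the existence of a tour. Success gives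
the required coloring whether or not a tour exists (`IsPlane.exists_isOrientationColoring`), so the
algorithm need not decide Hamiltonicity.

The topological input is that modulo two every cycle on the sphere bounds
(`IsTour.exists_coboundary_eq`). It follows from Euler's formula by a dimension count, the tour
minus one edge serving as a spanning tree. -/

namespace Ram

/-! ### Programs with counting loops: semantics and polynomial running time. -/

/-- The memory after `x := v`. -/
def State.setReg (s : State) (x v : ℕ) : State := ⟨Function.update s.reg x v, s.arr⟩

/-- The memory after `a[i] := v`. -/
def State.setArr (s : State) (a i v : ℕ) : State :=
  ⟨s.reg, Function.update s.arr a (Function.update (s.arr a) i v)⟩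

@[simp] theorem State.setReg_reg (s : State) (x v y : ℕ) :
    (s.setReg x v).reg y = if y = x then v else s.reg y := by
  simp [State.setReg, Function.update_apply]

@[simp] theorem State.setReg_arr (s : State) (x v : ℕ) : (s.setReg x v).arr = s.arr := rfl

@[simp] theorem State.setArr_reg (s : State) (a i v : ℕ) : (s.setArr a i v).reg = s.reg := rfl

@[simp] theorem State.setArr_arr (s : State) (a i v b j : ℕ) :
    (s.setArr a i v).arr b j = if b = a ∧ j = i then v else s.arr b j := by
  by_cases h : b = a
  · subst h
    by_cases hj : j = i <;> simp [State.setArr, hj]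
  · simp [State.setArr, h]

/-- Programs in which the only loops are counting loops, whose counter runs from `0` to
`2 * reg 1`. -/
inductive Code
  | skip
  | assign (x : ℕ) (e : Expr)
  | store (a : ℕ) (i e : Expr)
  | seq (P Q : Code)
  | cond (e : Expr) (P Q : Code)
  | count (x : ℕ) (P : Code)

namespace Code

/-- The program with `while` loops. -/
def compile : Code → Prog
  | skip => .skip
  | assign x e => .assign x e
  | store a i e => .store a i e
  | seq P Q => .seq P.compile Q.compile
  | cond e P Q => .cond e P.compile Q.compile
  | count x P => .seq (.assign x (.lit 0))
      (.loop (.sub (.add (.reg 1) (.reg 1)) (.reg x))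
        (.seq P.compile (.assign x (.add (.reg x) (.lit 1)))))

/-- The effect of a program on the memory. -/
def eval : Code → State → State
  | skip, s => s
  | assign x e, s => s.setReg x (e.eval s)
  | store a i e, s => s.setArr a (i.eval s) (e.eval s)
  | seq P Q, s => Q.eval (P.eval s)
  | cond e P Q, s => if e.eval s = 0 then Q.eval s else P.eval s
  | count x P, s =>
      (fun r => (P.eval r).setReg x ((P.eval r).reg x + 1))^[s.reg 1 + s.reg 1] (s.setReg x 0)

/-- The program may change the register `y`. -/
def Writes (y : ℕ) : Code → Prop
  | skip => False
  | assign x _ => y = x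
  | store _ _ _ => False
  | seq P Q => P.Writes y ∨ Q.Writes y
  | cond _ P Q => P.Writes y ∨ Q.Writes y
  | count x P => y = x ∨ P.Writes y

/-- Loop counters are changed by their loops only. -/
def CountersSafe : Code → Prop
  | skip => True
  | assign _ _ => True
  | store _ _ _ => True
  | seq P Q => P.CountersSafe ∧ Q.CountersSafe
  | cond _ P Q => P.CountersSafe ∧ Q.CountersSafe
  | count x P => ¬ P.Writes x ∧ P.CountersSafe

/-- A bound for the running time in terms of the register `1`. -/
noncomputable def time : Code → Polynomial ℕ
  | skip => 1
  | assign _ e => Polynomial.C (e.cost + 1)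
  | store _ i e => Polynomial.C (i.cost + e.cost + 1)
  | seq P Q => P.time + Q.time
  | cond e P Q => Polynomial.C (e.cost + 1) + P.time + Q.time
  | count _ P => 2 * Polynomial.X * (P.time + 10) + 8

theorem eval_reg_of_not_writes {y : ℕ} {P : Code} (h : ¬ P.Writes y) (s : State) :
    (P.eval s).reg y = s.reg y := by
  induction P generalizing s with
  | skip => rfl
  | assign x e =>
    have : y ≠ x := h
    simp [eval, this]
  | store a i e => rfl
  | seq P Q hP hQ =>
    simp only [Writes, not_or] at h
    rw [eval, hQ h.2, hP h.1]
  | cond e P Q hP hQ =>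
    simp only [Writes, not_or] at h
    rw [eval]
    split
    · exact hQ h.2 s
    · exact hP h.1 s
  | count x P hP =>
    simp only [Writes, not_or] at h
    rw [eval]
    have key : ∀ N r, ((fun r => (P.eval r).setReg x ((P.eval r).reg x + 1))^[N] r).reg y
        = r.reg y := by
      intro N
      induction N with
      | zero => intro r; rfl
      | succ N ih =>
        intro r
        rw [Function.iterate_succ_apply, ih]
        simp [h.1, hP h.2]
    rw [key]
    simp [h.1]

theorem runs_compile {P : Code} (hP : P.CountersSafe) (h1 : ¬ P.Writes 1) (s : State) :
    ∃ t, Runs P.compile s t (P.eval s) ∧ t ≤ P.time.eval (s.reg 1) := by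
  induction P generalizing s with
  | skip => exact ⟨_, .skip s, by simp [time]⟩
  | assign x e => exact ⟨_, .assign s x e, by simp [time]⟩
  | store a i e => exact ⟨_, .store s a i e, by simp [time]⟩
  | seq P Q ihP ihQ =>
    simp only [Writes, not_or] at h1
    obtain ⟨t, ht, htb⟩ := ihP hP.1 h1.1 s
    obtain ⟨t', ht', htb'⟩ := ihQ hP.2 h1.2 (P.eval s)
    rw [eval_reg_of_not_writes h1.1] at htb'
    refine ⟨_, .seq ht ht', ?_⟩
    simp only [time, Polynomial.eval_add]
    omega
  | cond e P Q ihP ihQ =>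
    simp only [Writes, not_or] at h1
    rw [eval]
    split
    · next h =>
      obtain ⟨t, ht, htb⟩ := ihQ hP.2 h1.2 s
      refine ⟨_, .cond_false h ht, ?_⟩
      simp only [time, Polynomial.eval_add, Polynomial.eval_C]
      omega
    · next h =>
      obtain ⟨t, ht, htb⟩ := ihP hP.1 h1.1 s
      refine ⟨_, .cond_true h ht, ?_⟩
      simp only [time, Polynomial.eval_add, Polynomial.eval_C]
      omega
  | count x P ih =>
    simp only [Writes, not_or] at h1
    -- `N` is the number of rounds left. Besides the body, a round costs 6 for the test and 4 for
    -- the increment; the final failing test costs 6. The initial assignment later adds 2, whence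
    -- the constants 10 and 8 in `time`.
    have key : ∀ N r, r.reg 1 + r.reg 1 = r.reg x + N →
        ∃ t, Runs (.loop (.sub (.add (.reg 1) (.reg 1)) (.reg x))
          (.seq P.compile (.assign x (.add (.reg x) (.lit 1))))) r t
          ((fun r => (P.eval r).setReg x ((P.eval r).reg x + 1))^[N] r) ∧
          t ≤ N * (P.time.eval (r.reg 1) + 10) + 6 := by
      intro N
      induction N with
      | zero =>
        intro r hr
        refine ⟨_, .loop_done ?_, ?_⟩
        · simp [Expr.eval]; omega
        · simp [Expr.cost]
      | succ N ihN =>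
        intro r hr
        obtain ⟨t, ht, htb⟩ := ih hP.2 h1.2 r
        have hx := eval_reg_of_not_writes hP.1 r
        have hone := eval_reg_of_not_writes h1.2 r
        obtain ⟨t', ht', htb'⟩ := ihN ((P.eval r).setReg x ((P.eval r).reg x + 1)) (by
          simp [h1.1, hx, hone]; omega)
        refine ⟨_, .loop_step ?_ (.seq ht (.assign _ _ _)) ht', ?_⟩
        · simp [Expr.eval]; omega
        · have : ((P.eval r).setReg x ((P.eval r).reg x + 1)).reg 1 = r.reg 1 := by
            simp [h1.1, hone]
          rw [this] at htb'
          simp only [Expr.cost, Nat.succ_mul] at *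
          omega
    obtain ⟨t, ht, htb⟩ := key (s.reg 1 + s.reg 1) (s.setReg x 0) (by simp [h1.1])
    refine ⟨_, .seq (.assign s x (.lit 0)) ht, ?_⟩
    have : (s.setReg x 0).reg 1 = s.reg 1 := by simp [h1.1]
    rw [this] at htb
    simp only [time, Polynomial.eval_add, Polynomial.eval_mul, Polynomial.eval_X,
      Polynomial.eval_ofNat, Expr.cost, two_mul]
    omega

/-- The rule for counting loops: `I k` holds when the counter reaches `k`. -/
theorem eval_count_induction {x : ℕ} {P : Code} (hx : ¬ P.Writes x) (I : ℕ → State → Prop)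
    (s : State) {N : ℕ} (hN : s.reg 1 + s.reg 1 = N) (h0 : I 0 (s.setReg x 0))
    (hstep : ∀ k < N, ∀ r, r.reg x = k → I k r → I (k + 1) ((P.eval r).setReg x (k + 1))) :
    I N ((count x P).eval s) := by
  rw [eval, hN]
  have key : ∀ k ≤ N,
      ((fun r => (P.eval r).setReg x ((P.eval r).reg x + 1))^[k] (s.setReg x 0)).reg x = k ∧
      I k ((fun r => (P.eval r).setReg x ((P.eval r).reg x + 1))^[k] (s.setReg x 0)) := by
    intro k
    induction k with
    | zero => intro _; exact ⟨by simp, h0⟩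
    | succ k ih =>
      intro hk
      obtain ⟨h, h'⟩ := ih (by omega)
      rw [Function.iterate_succ_apply']
      generalize ((fun r => (P.eval r).setReg x ((P.eval r).reg x + 1))^[k] (s.setReg x 0)) = r at *
      have hr := eval_reg_of_not_writes hx r
      rw [hr, h]
      exact ⟨by simp, hstep k (by omega) r h h'⟩
  exact (key N le_rfl).2

end Code

end Ram

/-! ### Tours and the local structure at a vertex. -/

namespace EmbeddedDigraph

variable {n m f : ℕ} {G : EmbeddedDigraph n m f} {Z : Finset (Fin m)}

/-- `Z` is the edge set of a directed Hamiltonian cycle, described vertex by vertex. -/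
structure IsTour (G : EmbeddedDigraph n m f) (Z : Finset (Fin m)) : Prop where
  pos : 0 < n
  card : Z.card = n
  exists_src : ∀ v, ∃ e ∈ Z, G.src e = v
  exists_tgt : ∀ v, ∃ e ∈ Z, G.tgt e = v
  src_inj : ∀ e ∈ Z, ∀ e' ∈ Z, G.src e = G.src e' → e = e'
  tgt_inj : ∀ e ∈ Z, ∀ e' ∈ Z, G.tgt e = G.tgt e' → e = e'
  conn : ∀ P : Fin n → Prop, (∀ e ∈ Z, P (G.src e) → P (G.tgt e)) → ∀ u v, P u → P v

/-- Replaces the indexed walk by conditions at the vertices. That there is only one cycle survives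
as the induction principle `conn`: a property passed on along the edges of the tour spreads to all
vertices. -/
theorem IsHamiltonianCycle.exists_isTour {C : Set (Fin m)} (hC : G.IsHamiltonianCycle C) :
    ∃ Z : Finset (Fin m), (Z : Set (Fin m)) = C ∧ G.IsTour Z := by
  obtain ⟨k, hk, w, rfl, hb, hw⟩ := hC
  have hkn : k = n := by simpa using Fintype.card_of_bijective hb
  have hb' : Function.Bijective fun i => G.tgt (w i) := by
    have : (fun i => G.tgt (w i)) = (fun i => G.src (w i)) ∘ finRotate k := funext hw
    rw [this]
    exact hb.comp (finRotate k).bijective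
  have hwi : Function.Injective w := fun i j h => hb.1 (by simp [h])
  refine ⟨Finset.univ.image w, by simp, ?_, ?_, ?_, ?_, ?_, ?_, ?_⟩
  · omega
  · rw [Finset.card_image_of_injective _ hwi]; simpa using hkn
  · intro v
    obtain ⟨i, hi⟩ := hb.2 v
    exact ⟨w i, by simp, hi⟩
  · intro v
    obtain ⟨i, hi⟩ := hb'.2 v
    exact ⟨w i, by simp, hi⟩
  · simp only [Finset.mem_image, Finset.mem_univ, true_and]
    rintro _ ⟨i, rfl⟩ _ ⟨j, rfl⟩ h
    rw [hb.1 h]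
  · simp only [Finset.mem_image, Finset.mem_univ, true_and]
    rintro _ ⟨i, rfl⟩ _ ⟨j, rfl⟩ h
    rw [hb'.1 h]
  · intro P hP u v hu
    obtain ⟨i, rfl⟩ := hb.2 u
    obtain ⟨j, rfl⟩ := hb.2 v
    obtain ⟨k, rfl⟩ : ∃ k', k = k' + 1 := ⟨k - 1, by omega⟩
    have key : ∀ l : Fin (k + 1), P (G.src (w (i + l))) := by
      intro l
      induction l using Fin.induction with
      | zero => simpa using hu
      | succ l ih =>
        have := hP _ (by simp) ih
        rw [hw, finRotate_apply] at this
        rwa [← Fin.coeSucc_eq_succ, ← add_assoc]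
    simpa using key (j - i)

@[simp] theorem rev_rev (d : Fin m × Bool) : rev (rev d) = d := by simp [rev]

@[simp] theorem rev_fst (d : Fin m × Bool) : (rev d).1 = d.1 := rfl

@[simp] theorem rev_snd (d : Fin m × Bool) : (rev d).2 = !d.2 := rfl

theorem IsPlane.vert_rot (hG : G.IsPlane) (d : Fin m × Bool) : G.vert (G.rot d) = G.vert d :=
  ((hG.rot_cycle d (G.rot d)).1 ⟨1, by simp⟩).symm

theorem IsPlane.rot_ne (hG : G.IsPlane) {d d' : Fin m × Bool} (h : G.vert d = G.vert d')
    (hne : d ≠ d') : G.rot d ≠ d := by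
  intro hd
  obtain ⟨k, hk⟩ := (hG.rot_cycle d d').2 h
  rw [Equiv.Perm.zpow_apply_eq_self_of_apply_eq_self hd] at hk
  exact hne hk

theorem MaxDegreeLE.eq_or_eq_or_eq (hdeg : G.MaxDegreeLE 3) {a b c x : Fin m × Bool}
    (hab : a ≠ b) (hac : a ≠ c) (hbc : b ≠ c) (hb : G.vert b = G.vert a)
    (hc : G.vert c = G.vert a) (hx : G.vert x = G.vert a) : x = a ∨ x = b ∨ x = c := by
  by_contra! h
  have hsub : ({x, a, b, c} : Finset (Fin m × Bool)) ⊆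
      Finset.univ.filter fun d => G.vert d = G.vert a := by
    intro y hy
    simp only [Finset.mem_insert, Finset.mem_singleton] at hy
    rcases hy with rfl | rfl | rfl | rfl <;> simp [*]
  have h4 : ({x, a, b, c} : Finset (Fin m × Bool)).card = 4 := by
    rw [Finset.card_insert_of_notMem (by simp [h]), Finset.card_insert_of_notMem (by simp [*]),
      Finset.card_insert_of_notMem (by simp [*]), Finset.card_singleton]
  have := Finset.card_le_card hsub
  have := hdeg (G.vert a)
  omega

/-- At a vertex of a tour there are two darts of the tour, of opposite directions, and at most
one other dart. -/
theorem IsTour.vertex_cases (hZ : G.IsTour Z) (hG : G.IsPlane) (hdeg : G.MaxDegreeLE 3)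
    (v : Fin n) :
    (∃ a b, a.1 ∈ Z ∧ b.1 ∈ Z ∧ b.2 ≠ a.2 ∧ (∀ x, G.vert x = v → x = a ∨ x = b) ∧
      G.rot a = b ∧ G.rot b = a) ∨
    (∃ d a b, d.1 ∉ Z ∧ a.1 ∈ Z ∧ b.1 ∈ Z ∧ a.2 = d.2 ∧ b.2 ≠ d.2 ∧
      (∀ x, G.vert x = v → x = d ∨ x = a ∨ x = b) ∧
      ((G.rot d = a ∧ G.rot a = b ∧ G.rot b = d) ∨
        (G.rot d = b ∧ G.rot b = a ∧ G.rot a = d))) := by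
  obtain ⟨o, hoZ, ho⟩ := hZ.exists_src v
  obtain ⟨i, hiZ, hi⟩ := hZ.exists_tgt v
  have hov : G.vert (o, true) = v := by simpa [vert] using ho
  have hiv : G.vert (i, false) = v := by simpa [vert] using hi
  have hmem : ∀ x : Fin m × Bool, G.vert x = v → x.1 ∈ Z → x = (o, true) ∨ x = (i, false) := by
    rintro ⟨e, b⟩ hx he
    cases b
    · right
      simp only [vert] at hx
      rw [hZ.tgt_inj e he i hiZ (by simp at hx; rw [hx, hi])]
    · left
      simp only [vert] at hx
      rw [hZ.src_inj e he o hoZ (by simp at hx; rw [hx, ho])]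
  have hoi : ((o, true) : Fin m × Bool) ≠ (i, false) := by simp
  have hro := hG.rot_ne (hov.trans hiv.symm) hoi
  have hri := hG.rot_ne (hiv.trans hov.symm) hoi.symm
  have hvo : G.vert (G.rot (o, true)) = v := (hG.vert_rot _).trans hov
  have hvi : G.vert (G.rot (i, false)) = v := (hG.vert_rot _).trans hiv
  by_cases hd : ∃ d, G.vert d = v ∧ d.1 ∉ Z
  · obtain ⟨d, hdv, hdZ⟩ := hd
    right
    have hdo : d ≠ (o, true) := by rintro rfl; exact hdZ hoZ
    have hdi : d ≠ (i, false) := by rintro rfl; exact hdZ hiZ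
    have hrd := hG.rot_ne (hdv.trans hov.symm) hdo
    have hvd : G.vert (G.rot d) = v := (hG.vert_rot _).trans hdv
    have hall : ∀ x, G.vert x = v → x = d ∨ x = (o, true) ∨ x = (i, false) := fun x hx =>
      hdeg.eq_or_eq_or_eq hdo hdi hoi (by rw [hov, hdv]) (by rw [hiv, hdv]) (by rw [hx, hdv])
    have h1 := hall _ hvo
    have h2 := hall _ hvi
    have h3 := hall _ hvd
    have i1 := G.rot.injective.ne hdo
    have i2 := G.rot.injective.ne hdi
    have i3 := G.rot.injective.ne hoi
    -- A permutation of three darts without fixed points is one of the two 3-cycles.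
    have hcyc : (G.rot d = (o, true) ∧ G.rot (o, true) = (i, false) ∧ G.rot (i, false) = d) ∨
        (G.rot d = (i, false) ∧ G.rot (i, false) = (o, true) ∧ G.rot (o, true) = d) := by
      grind
    cases hd2 : d.2
    · exact ⟨d, (i, false), (o, true), hdZ, hiZ, hoZ, by simp [hd2], by simp [hd2],
        fun x hx => by rcases hall x hx with h | h | h <;> simp [h], hcyc.symm⟩
    · exact ⟨d, (o, true), (i, false), hdZ, hoZ, hiZ, by simp [hd2], by simp [hd2], hall, hcyc⟩
  · push Not at hd
    left
    have hall : ∀ x, G.vert x = v → x = (o, true) ∨ x = (i, false) := fun x hx =>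
      hmem x hx (hd x hx)
    refine ⟨(o, true), (i, false), hoZ, hiZ, by simp, hall, ?_, ?_⟩
    · exact (hall _ hvo).resolve_left hro
    · exact (hall _ hvi).resolve_right hri

/-- A dart function that does not change around the vertices and across the edges of a tour is
constant. -/
theorem IsTour.dart_const (hZ : G.IsTour Z) (hG : G.IsPlane) {α : Type*}
    (γ : Fin m × Bool → α) (hrot : ∀ x, γ (G.rot x) = γ x)
    (hrev : ∀ x, x.1 ∈ Z → γ (rev x) = γ x) (x y : Fin m × Bool) : γ x = γ y := by
  have hpow : ∀ (k : ℕ) x, γ ((G.rot ^ k) x) = γ x := by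
    intro k
    induction k with
    | zero => simp
    | succ k ih => intro x; rw [pow_succ', Equiv.Perm.mul_apply, hrot, ih]
  have hv : ∀ x y, G.vert x = G.vert y → γ x = γ y := by
    intro x y h
    obtain ⟨k, hk⟩ := ((hG.rot_cycle x y).2 h).exists_nat_pow_eq
    rw [← hk, hpow]
  refine hZ.conn (fun v => ∀ z, G.vert z = v → γ x = γ z) ?_ (G.vert x) (G.vert y) ?_ y rfl
  · intro e he h z hz
    rw [h (e, true) (by simp [vert]), ← hrev _ he]
    exact hv _ _ (by rw [hz]; simp [vert, rev])
  · exact fun z hz => hv _ _ hz.symm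

/-- Connectedness of the incidence graph puts a vertex on the boundary of the face. A tour leaves no
vertex isolated, so even the face `vface v` belongs to a corner. -/
theorem IsTour.exists_left_eq (hZ : G.IsTour Z) (hG : G.IsPlane) (x : Fin f) :
    ∃ d, G.left d = x := by
  obtain ⟨v, hv⟩ : ∃ v, G.Incident v x := by
    have hne : (Sum.inr x : Fin n ⊕ Fin f) ≠ Sum.inl ⟨0, hZ.pos⟩ := by simp
    obtain ⟨p⟩ := hG.connected.preconnected (Sum.inr x) (Sum.inl ⟨0, hZ.pos⟩)
    cases p with
    | cons h _ =>
      simp only [incidenceGraph, SimpleGraph.fromRel_adj] at h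
      rcases h.2 with ⟨v, y, h1, h2, h3⟩ | ⟨v, y, h1, h2, h3⟩
      · simp at h1
      · cases h2; exact ⟨v, h3⟩
  rcases hv with hv | ⟨d, -, hd⟩
  · obtain ⟨o, -, ho⟩ := hZ.exists_src v
    obtain ⟨d', -, hd'⟩ := hG.vface_corner (o, true)
    refine ⟨d', hd'.trans ?_⟩
    rw [← hv]
    simp [vert, ho]
  · exact ⟨d, hd⟩

theorem IsTour.euler (hZ : G.IsTour Z) (hG : G.IsPlane) : n + f = m + 2 := by
  have h := hG.euler
  have hc : Nat.card G.Component = 1 := by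
    rw [Nat.card_eq_one_iff_unique]
    refine ⟨⟨fun a b => ?_⟩, ⟨Quot.mk _ ⟨0, hZ.pos⟩⟩⟩
    induction a using Quot.inductionOn with | _ a => ?_
    induction b using Quot.inductionOn with | _ b => ?_
    refine hZ.conn (fun v => (Quot.mk _ a : G.Component) = Quot.mk _ v) ?_ a b rfl
    exact fun e _ he => he.trans (Quot.sound ⟨e, rfl, rfl⟩)
  omega

/-! ### Modulo-two cycles and functions on the faces. -/

/-- The difference of `Y` across the edges. -/
def coboundary (G : EmbeddedDigraph n m f) : (Fin f → ZMod 2) →ₗ[ZMod 2] (Fin m → ZMod 2) where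
  toFun Y e := Y (G.left (e, true)) + Y (G.left (e, false))
  map_add' Y Y' := by ext e; simp; ring
  map_smul' c Y := by ext e; simp; ring

theorem coboundary_apply (Y : Fin f → ZMod 2) (x : Fin m × Bool) :
    G.coboundary Y x.1 = Y (G.left x) + Y (G.left (rev x)) := by
  obtain ⟨e, b⟩ := x
  cases b <;> simp [coboundary, rev, add_comm]

theorem add_add_self_left (a b : ZMod 2) : a + (a + b) = b := by
  rw [← add_assoc, CharTwo.add_self_eq_zero, zero_add]

/-- An edge function of the form `χ + δ Y`, where `χ` has a potential on the darts, vanishes if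
it vanishes outside a tour and on one edge of the tour. -/
theorem IsTour.coboundary_eq (hZ : G.IsTour Z) (hG : G.IsPlane) (hdeg : G.MaxDegreeLE 3)
    {χ : Fin m → ZMod 2} {q : Fin m × Bool → ZMod 2}
    (hrot : ∀ x, q (G.rot x) + q x = χ (G.rot x).1) {z : Fin m} (hz : z ∈ Z)
    {Y : Fin f → ZMod 2} (hY : ∀ e, e ∉ Z ∨ e = z → G.coboundary Y e = χ e) :
    G.coboundary Y = χ := by
  -- Passing a dart changes `Y + q` by the value of `δY + χ` on its edge. Going once around a
  -- vertex, these changes sum to zero.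
  have hjump : ∀ x, (Y (G.left (G.rot x)) + q (G.rot x)) + (Y (G.left x) + q x) =
      G.coboundary Y (G.rot x).1 + χ (G.rot x).1 := by
    intro x
    rw [coboundary_apply, hG.left_rot, ← hrot]
    ring
  -- Since `δY + χ` vanishes off the tour, its values on the two tour edges at a vertex coincide; it
  -- is then constant along the tour, and zero at `z`.
  have hpair : ∀ x y, G.vert x = G.vert y → x.1 ∈ Z → y.1 ∈ Z →
      G.coboundary Y x.1 + χ x.1 = G.coboundary Y y.1 + χ y.1 := by
    intro x y hxy hx hy
    rcases hZ.vertex_cases hG hdeg (G.vert x) with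
      ⟨a, b, -, -, -, hall, hab, hba⟩ | ⟨d, a, b, hd, -, -, -, -, hall, hcyc⟩
    · have h1 := hjump a
      have h2 := hjump b
      rw [hab] at h1
      rw [hba] at h2
      have : G.coboundary Y a.1 + χ a.1 = G.coboundary Y b.1 + χ b.1 := by
        rw [← h1, ← h2, add_comm]
      rcases hall x rfl with rfl | rfl <;> rcases hall y hxy.symm with rfl | rfl <;>
        first | rfl | exact this | exact this.symm
    · have h3 : G.coboundary Y d.1 + χ d.1 = 0 := by
        rw [hY _ (.inl hd), CharTwo.add_self_eq_zero]
      have : G.coboundary Y a.1 + χ a.1 = G.coboundary Y b.1 + χ b.1 := by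
        have hsum : (G.coboundary Y a.1 + χ a.1) + (G.coboundary Y b.1 + χ b.1) +
            (G.coboundary Y d.1 + χ d.1) = 0 := by
          rcases hcyc with ⟨r1, r2, r3⟩ | ⟨r1, r2, r3⟩
          · have h1 := hjump d
            have h2 := hjump a
            have h4 := hjump b
            rw [r1] at h1
            rw [r2] at h2
            rw [r3] at h4
            linear_combination (CharTwo.add_self_eq_zero (Y (G.left d) + q d)) +
              (CharTwo.add_self_eq_zero (Y (G.left a) + q a)) +
              (CharTwo.add_self_eq_zero (Y (G.left b) + q b)) - h1 - h2 - h4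
          · have h1 := hjump d
            have h2 := hjump b
            have h4 := hjump a
            rw [r1] at h1
            rw [r2] at h2
            rw [r3] at h4
            linear_combination (CharTwo.add_self_eq_zero (Y (G.left d) + q d)) +
              (CharTwo.add_self_eq_zero (Y (G.left a) + q a)) +
              (CharTwo.add_self_eq_zero (Y (G.left b) + q b)) - h1 - h2 - h4
        rwa [h3, add_zero, CharTwo.add_eq_zero] at hsum
      rcases hall x rfl with rfl | rfl | rfl <;>
        rcases hall y hxy.symm with rfl | rfl | rfl <;>
        first | rfl | exact this | exact this.symm | contradiction
  have hzero : ∀ e ∈ Z, G.coboundary Y e + χ e = 0 := by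
    have := hZ.conn (fun v => ∀ e ∈ Z, G.src e = v → G.coboundary Y e + χ e = 0) (by
      intro e he h e' he' h'
      rw [← h e he rfl]
      exact hpair (e', true) (e, false) (by simpa [vert] using h') he' he) (G.src z)
    intro e he
    refine this (G.src e) ?_ e he rfl
    intro e' he' h
    rw [hZ.src_inj e' he' z hz h, hY _ (.inr rfl), CharTwo.add_self_eq_zero]
  ext e
  by_cases he : e ∈ Z
  · exact CharTwo.add_eq_zero.1 (hzero e he)
  · exact hY e (.inl he)

/-- An edge function with a potential on the darts is a coboundary: in the plane every cycle
modulo two is the boundary of a set of faces. -/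
theorem IsTour.exists_coboundary_eq (hZ : G.IsTour Z) (hG : G.IsPlane) (hdeg : G.MaxDegreeLE 3)
    {χ : Fin m → ZMod 2} {q : Fin m × Bool → ZMod 2}
    (hrot : ∀ x, q (G.rot x) + q x = χ (G.rot x).1) :
    ∃ Y, G.coboundary Y = χ := by
  obtain ⟨z, hz, -⟩ := hZ.exists_src ⟨0, hZ.pos⟩
  -- The edges outside the spanning path `Z \ {z}`. By Euler's formula there are `m - (n - 1) = f -
  -- 1` of them.
  let W : Finset (Fin m) := (Z.erase z)ᶜ
  have hW : ∀ e, e ∈ W ↔ e ∉ Z ∨ e = z := by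
    intro e
    simp only [W, Finset.mem_compl, Finset.mem_erase]
    tauto
  let T : (Fin f → ZMod 2) →ₗ[ZMod 2] (W → ZMod 2) :=
    (LinearMap.funLeft (ZMod 2) (ZMod 2) (fun e : W => (e : Fin m))).comp G.coboundary
  have hT : ∀ Y (e : W), T Y e = G.coboundary Y e := fun _ _ => rfl
  -- If `δY` vanishes on `W`, it vanishes everywhere, so `Y` is constant. The kernel has dimension
  -- at most one, the rank is at least `f - 1`, and `T` is onto.
  have hker : LinearMap.ker T ≤ Submodule.span (ZMod 2) {fun _ => 1} := by
    intro Y hY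
    have h0 : G.coboundary Y = 0 := by
      refine hZ.coboundary_eq hG hdeg (χ := 0) (q := 0) (by simp) hz fun e he => ?_
      rw [← hT Y ⟨e, (hW e).2 he⟩, LinearMap.mem_ker.1 hY]
      rfl
    have hrev : ∀ x, Y (G.left (rev x)) = Y (G.left x) := by
      intro x
      have := coboundary_apply (G := G) Y x
      rw [h0] at this
      exact (CharTwo.add_eq_zero.1 this.symm).symm
    have hconst := hZ.dart_const hG (fun x => Y (G.left x))
      (fun x => by rw [← hrev, hG.left_rot]) (fun x _ => hrev x)
    rw [Submodule.mem_span_singleton]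
    refine ⟨Y (G.left (z, true)), ?_⟩
    ext x
    obtain ⟨d, rfl⟩ := hZ.exists_left_eq hG x
    simpa using hconst _ _
  have hk1 : Module.finrank (ZMod 2) (LinearMap.ker T) ≤ 1 :=
    (Submodule.finrank_mono hker).trans ((finrank_span_le_card _).trans (by simp))
  have hsurj : LinearMap.range T = ⊤ := by
    apply Submodule.eq_top_of_finrank_eq
    have h1 := LinearMap.finrank_range_add_finrank_ker T
    have h2 := (LinearMap.range T).finrank_le
    have h3 := hZ.euler hG
    have h4 : W.card = m - (n - 1) := by
      rw [Finset.card_compl, Finset.card_erase_of_mem hz, hZ.card, Fintype.card_fin]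
    have h5 : n ≤ m := by simpa [hZ.card] using Finset.card_le_univ Z
    have h6 := hZ.pos
    simp only [Module.finrank_fintype_fun_eq_card, Fintype.card_fin, Fintype.card_coe] at *
    omega
  obtain ⟨Y, hY⟩ := LinearMap.range_eq_top.1 hsurj fun e => χ e
  refine ⟨Y, hZ.coboundary_eq hG hdeg hrot hz fun e he => ?_⟩
  rw [← hT Y ⟨e, (hW e).2 he⟩, hY]

/-- A dart function with the jumps of an edge function descends to the faces. -/
theorem IsTour.exists_face_function (hZ : G.IsTour Z) (hG : G.IsPlane) (hdeg : G.MaxDegreeLE 3)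
    {χ : Fin m → ZMod 2} {q : Fin m × Bool → ZMod 2}
    (hrot : ∀ x, q (G.rot x) + q x = χ (G.rot x).1)
    (hrev : ∀ x, x.1 ∈ Z → q (rev x) + q x = χ x.1) :
    ∃ Y : Fin f → ZMod 2, ∀ x, Y (G.left x) = q x := by
  obtain ⟨Y, hY⟩ := hZ.exists_coboundary_eq hG hdeg hrot
  obtain ⟨z, -, -⟩ := hZ.exists_src ⟨0, hZ.pos⟩
  -- `Y ∘ left` and `q` have the same jumps around vertices and across tour edges, so they differ by
  -- a constant, which is then absorbed into `Y`.
  have hconst := hZ.dart_const hG (fun x => Y (G.left x) + q x) (fun x => by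
      have h1 := coboundary_apply (G := G) Y (G.rot x)
      rw [hY, ← hrot, hG.left_rot] at h1
      rw [← CharTwo.add_eq_zero]
      linear_combination CharTwo.add_self_eq_zero (q (G.rot x) + q x) - h1)
    (fun x hx => by
      have h1 := coboundary_apply (G := G) Y x
      rw [hY, ← hrev x hx] at h1
      rw [← CharTwo.add_eq_zero]
      linear_combination CharTwo.add_self_eq_zero (q (rev x) + q x) - h1)
  refine ⟨fun y => Y y + (Y (G.left (z, true)) + q (z, true)), fun x => ?_⟩
  rw [← hconst x]
  exact add_add_self_left _ _

/-- Every dart is `rot y` for some `y`, and the face to the right of `rot y` is that to the left of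
`y`. A potential that descends to the faces thus has the right jump across all edges, including
those off the tour, where this was not assumed. -/
theorem rev_add_of_face_function (hG : G.IsPlane)
    {χ : Fin m → ZMod 2} {q : Fin m × Bool → ZMod 2}
    (hrot : ∀ x, q (G.rot x) + q x = χ (G.rot x).1) {Y : Fin f → ZMod 2}
    (hY : ∀ x, Y (G.left x) = q x) (x : Fin m × Bool) : q (rev x) + q x = χ x.1 := by
  obtain ⟨y, rfl⟩ := G.rot.surjective x
  rw [← hrot, ← hY (rev _), hG.left_rot, hY, add_comm]

end EmbeddedDigraph

/-! ### Deductions about Hamiltonian cycles. -/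

namespace EmbeddedDigraph

variable {n m f : ℕ} {G : EmbeddedDigraph n m f} {Z : Finset (Fin m)} {val : Fin m → ℕ}

/-- At a vertex of degree at most three, the other dart of the same direction as `d` (or `d`, if
there is none). -/
def partner (G : EmbeddedDigraph n m f) (d : Fin m × Bool) : Fin m × Bool :=
  if (G.rot d).2 = d.2 then G.rot d
  else if (G.rot (G.rot d)).2 = d.2 then G.rot (G.rot d) else d

/-- What can be deduced about the edge of `d`. The values `0`, `1`, `2` mean that an edge lies on
no Hamiltonian cycle, is undecided, lies on every Hamiltonian cycle. -/
def deduced (G : EmbeddedDigraph n m f) (val : Fin m → ℕ) (d : Fin m × Bool) : ℕ :=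
  if G.partner d = d ∨ (G.rot d).2 ≠ (G.rot (rev d)).2 then 2 else 2 - val (G.partner d).1

/-- No undecided edge can be decided. -/
def Stable (G : EmbeddedDigraph n m f) (val : Fin m → ℕ) : Prop :=
  ∀ d, val d.1 = 1 → G.deduced val d = 1

/-- The edges decided by `val` are decided correctly for `Z`. -/
def Agrees (val : Fin m → ℕ) (Z : Finset (Fin m)) : Prop :=
  ∀ e, val e ≤ 2 ∧ (val e = 0 → e ∉ Z) ∧ (val e = 2 → e ∈ Z)

/-- The color of the face to the left of `d`, read off at the vertex of `d`: `1`, `2`, `3` stand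
for blue, white, yellow. -/
def cornerColor (G : EmbeddedDigraph n m f) (val : Fin m → ℕ) (d : Fin m × Bool) : ℕ :=
  if val d.1 = 0 then if (G.rot d).2 then 1 else 2
  else if (if val (G.rot d).1 = 0 then G.rot (G.rot d) else G.rot d).2 = d.2 then 3
  else if d.2 then 2 else 1

/-- The colors of the faces are consistent along the edges. -/
def ColorsMatch (G : EmbeddedDigraph n m f) (val : Fin m → ℕ) : Prop :=
  ∀ d, G.cornerColor val d = G.cornerColor val (rev d) ↔ val d.1 = 0

open Classical in
/-- The side of the tour on which the corner after a dart lies. -/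
noncomputable def tourSide (G : EmbeddedDigraph n m f) (Z : Finset (Fin m))
    (d : Fin m × Bool) : ZMod 2 :=
  if d.1 ∈ Z then (if d.2 then 1 else 0) else (if (G.rot d).2 then 0 else 1)

open Classical in
theorem IsTour.tourSide_rot (hZ : G.IsTour Z) (hG : G.IsPlane) (hdeg : G.MaxDegreeLE 3)
    (x : Fin m × Bool) :
    G.tourSide Z (G.rot x) + G.tourSide Z x = if (G.rot x).1 ∈ Z then 1 else 0 := by
  have h2 : (1 : ZMod 2) + 1 = 0 := by decide
  rcases hZ.vertex_cases hG hdeg (G.vert x) with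
    ⟨a, b, ha, hb, hab, hall, r1, r2⟩ | ⟨d, a, b, hd, ha, hb, had, hbd, hall, hcyc⟩
  · rcases hall x rfl with rfl | rfl
    · cases h : x.2 <;> cases h' : b.2 <;> simp_all [tourSide]
    · cases h : x.2 <;> cases h' : a.2 <;> simp_all [tourSide]
  · rcases hcyc with ⟨r1, r2, r3⟩ | ⟨r1, r2, r3⟩ <;> rcases hall x rfl with hx | hx | hx <;>
      rw [hx] <;> clear hall hx x <;> cases h : d.2 <;> cases h' : b.2 <;>
      simp_all [tourSide]

open Classical in
-- The Jordan curve theorem for the tour: the side read off at a corner changes exactly across tour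
-- edges, so it is a function of the face.
theorem IsTour.exists_side (hZ : G.IsTour Z) (hG : G.IsPlane) (hdeg : G.MaxDegreeLE 3) :
    ∃ σ : Fin f → ZMod 2, ∀ x, σ (G.left x) = G.tourSide Z x :=
  hZ.exists_face_function hG hdeg (χ := fun e => if e ∈ Z then 1 else 0)
    (hZ.tourSide_rot hG hdeg) (by
      intro x hx
      cases h : x.2 <;> simp [tourSide, hx, h])

open Classical in
theorem IsTour.tourSide_rev (hZ : G.IsTour Z) (hG : G.IsPlane) (hdeg : G.MaxDegreeLE 3)
    (x : Fin m × Bool) :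
    G.tourSide Z (rev x) + G.tourSide Z x = if x.1 ∈ Z then 1 else 0 := by
  obtain ⟨σ, hσ⟩ := hZ.exists_side hG hdeg
  exact rev_add_of_face_function hG (χ := fun e => if e ∈ Z then 1 else 0)
    (hZ.tourSide_rot hG hdeg) hσ x

theorem IsTour.partner_mem (hZ : G.IsTour Z) (hG : G.IsPlane) (hdeg : G.MaxDegreeLE 3)
    {x : Fin m × Bool} (hx : x.1 ∉ Z) : (G.partner x).1 ∈ Z := by
  rcases hZ.vertex_cases hG hdeg (G.vert x) with
    ⟨a, b, ha, hb, hab, hall, r1, r2⟩ | ⟨d, a, b, hd, ha, hb, had, hbd, hall, hcyc⟩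
  · rcases hall x rfl with rfl | rfl <;> contradiction
  · rcases hcyc with ⟨r1, r2, r3⟩ | ⟨r1, r2, r3⟩ <;> rcases hall x rfl with rfl | rfl | rfl <;>
      first | contradiction | simp_all [partner]

theorem IsTour.partner_notMem (hZ : G.IsTour Z) (hG : G.IsPlane) (hdeg : G.MaxDegreeLE 3)
    {x : Fin m × Bool} (hx : x.1 ∈ Z) (hp : G.partner x ≠ x) : (G.partner x).1 ∉ Z := by
  rcases hZ.vertex_cases hG hdeg (G.vert x) with
    ⟨a, b, ha, hb, hab, hall, r1, r2⟩ | ⟨d, a, b, hd, ha, hb, had, hbd, hall, hcyc⟩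
  · rcases hall x rfl with rfl | rfl <;> simp_all [partner]
  · rcases hcyc with ⟨r1, r2, r3⟩ | ⟨r1, r2, r3⟩ <;> rcases hall x rfl with rfl | rfl | rfl <;>
      (simp_all [partner]; try grind)

/-- The direction of the tour dart following an off-tour dart tells on which side of the tour the
latter lies, and both ends of an edge off the tour lie on the same side. -/
theorem IsTour.rot_rev_snd (hZ : G.IsTour Z) (hG : G.IsPlane) (hdeg : G.MaxDegreeLE 3)
    {x : Fin m × Bool} (hx : x.1 ∉ Z) : (G.rot (rev x)).2 = (G.rot x).2 := by
  have h := hZ.tourSide_rev hG hdeg x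
  simp only [tourSide, rev_fst, hx, if_false] at h
  cases h1 : (G.rot x).2 <;> cases h2 : (G.rot (rev x)).2 <;> simp_all

/-- Deductions are correct. -/
theorem IsTour.deduced_correct (hZ : G.IsTour Z) (hG : G.IsPlane) (hdeg : G.MaxDegreeLE 3)
    (hval : Agrees val Z) (d : Fin m × Bool) : G.deduced val d ≤ 2 ∧
      (G.deduced val d = 0 → d.1 ∉ Z) ∧ (G.deduced val d = 2 → d.1 ∈ Z) := by
  have h1 := fun h => hZ.partner_mem hG hdeg (x := d) h
  have h2 := fun h => hZ.rot_rev_snd hG hdeg (x := d) h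
  have h3 := fun h => hZ.partner_notMem hG hdeg (x := d) h
  obtain ⟨h4, h5, h6⟩ := hval (G.partner d).1
  unfold deduced
  split
  · next h =>
    refine ⟨le_rfl, by simp, fun _ => ?_⟩
    by_contra hd
    rcases h with h | h
    · rw [h] at h1
      exact hd (h1 hd)
    · exact h (h2 hd).symm
  · next h =>
    push Not at h
    refine ⟨by omega, fun h0 hd => h3 hd h.1 (h6 (by omega)), fun h0 => ?_⟩
    by_contra hd
    exact h5 (by omega) (h1 hd)

/-! ### The coloring in the presence of a tour. -/

theorem IsTour.partner_stable (hval : Agrees val Z) (hst : G.Stable val)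
    {x : Fin m × Bool} (hx : val x.1 = 1) :
    G.partner x ≠ x ∧ (G.rot x).2 = (G.rot (rev x)).2 ∧ val (G.partner x).1 = 1 := by
  have h := hst x hx
  have h' := (hval (G.partner x).1).1
  unfold deduced at h
  split at h
  · simp at h
  · next h0 =>
    push Not at h0
    exact ⟨h0.1, h0.2, by omega⟩

/-- The values at a vertex with three darts. -/
theorem IsTour.val_cases (hval : Agrees val Z) (hst : G.Stable val) {d a b : Fin m × Bool}
    (hd : d.1 ∉ Z) (ha : a.1 ∈ Z) (hb : b.1 ∈ Z) (had : a.2 = d.2) (hbd : b.2 ≠ d.2)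
    (hcyc : (G.rot d = a ∧ G.rot a = b ∧ G.rot b = d) ∨
        (G.rot d = b ∧ G.rot b = a ∧ G.rot a = d)) :
    val b.1 = 2 ∧ ((val d.1 = 0 ∧ val a.1 = 2) ∨ (val d.1 = 1 ∧ val a.1 = 1)) := by
  have pd : G.partner d = a := by
    rcases hcyc with ⟨r1, r2, r3⟩ | ⟨r1, r2, r3⟩ <;> simp_all [partner]
  have pa : G.partner a = d := by
    rcases hcyc with ⟨r1, r2, r3⟩ | ⟨r1, r2, r3⟩ <;> simp_all [partner]
  -- `b` is the only dart of its direction here, so it has no partner and stability forbids it to be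
  -- undecided.
  have pb : G.partner b = b := by
    rcases hcyc with ⟨r1, r2, r3⟩ | ⟨r1, r2, r3⟩ <;> simp [partner, *, hbd.symm]
  have hb1 : val b.1 ≠ 1 := fun h => (partner_stable hval hst h).1 pb
  have hda : val d.1 = 1 → val a.1 = 1 := fun h => pd ▸ (partner_stable hval hst h).2.2
  have had : val a.1 = 1 → val d.1 = 1 := fun h => pa ▸ (partner_stable hval hst h).2.2
  have h1 := hval d.1
  have h2 := hval a.1
  have h3 := hval b.1
  have h4 : val d.1 ≠ 2 := fun h => hd (h1.2.2 h)
  have h5 : val a.1 ≠ 0 := fun h => h2.2.1 h ha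
  have h6 : val b.1 ≠ 0 := fun h => h3.2.1 h hb
  omega

/-- The values at a vertex with two darts. -/
theorem IsTour.val_eq_two (hval : Agrees val Z) (hst : G.Stable val) {a b : Fin m × Bool}
    (ha : a.1 ∈ Z) (hab : b.2 ≠ a.2) (r1 : G.rot a = b) (r2 : G.rot b = a) : val a.1 = 2 := by
  have pa : G.partner a = a := by simp [partner, r1, r2, hab]
  have h1 : val a.1 ≠ 1 := fun h => (partner_stable hval hst h).1 pa
  have h2 := hval a.1
  have h5 : val a.1 ≠ 0 := fun h => h2.2.1 h ha
  omega

/-- The yellow corners are the corners between two undecided edges. -/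
theorem IsTour.cornerColor_eq_three (hZ : G.IsTour Z) (hG : G.IsPlane) (hdeg : G.MaxDegreeLE 3)
    (hval : Agrees val Z) (hst : G.Stable val) (x : Fin m × Bool) :
    G.cornerColor val x = 3 ↔ val x.1 = 1 ∧ (G.rot x).2 = x.2 := by
  rcases hZ.vertex_cases hG hdeg (G.vert x) with
    ⟨a, b, ha, hb, hab, hall, r1, r2⟩ | ⟨d, a, b, hd, ha, hb, had, hbd, hall, hcyc⟩
  · have h1 := val_eq_two hval hst ha hab r1 r2
    have h2 := val_eq_two hval hst hb hab.symm r2 r1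
    rcases hall x rfl with rfl | rfl <;> grind [cornerColor]
  · have hv := val_cases hval hst hd ha hb had hbd hcyc
    rcases hall x rfl with rfl | rfl | rfl <;> grind [cornerColor]

/-- At each vertex the undecided darts, if any, are two partners, and the corner between them is its
one yellow corner; so yellowness changes exactly at undecided darts. Across an undecided edge,
stability gives equal directions to the darts following its two ends, while the ends themselves have
opposite directions; hence exactly one side is yellow. -/
theorem IsTour.exists_yellow (hZ : G.IsTour Z) (hG : G.IsPlane) (hdeg : G.MaxDegreeLE 3)
    (hval : Agrees val Z) (hst : G.Stable val) :
    ∃ Y : Fin f → ZMod 2, (∀ x, Y (G.left x) = if G.cornerColor val x = 3 then 1 else 0) ∧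
      ∀ x, Y (G.left (rev x)) + Y (G.left x) = if val x.1 = 1 then 1 else 0 := by
  have hrot : ∀ x, (if G.cornerColor val (G.rot x) = 3 then (1 : ZMod 2) else 0) +
      (if G.cornerColor val x = 3 then 1 else 0) = if val (G.rot x).1 = 1 then 1 else 0 := by
    intro x
    simp only [hZ.cornerColor_eq_three hG hdeg hval hst]
    rcases hZ.vertex_cases hG hdeg (G.vert x) with
      ⟨a, b, ha, hb, hab, hall, r1, r2⟩ | ⟨d, a, b, hd, ha, hb, had, hbd, hall, hcyc⟩
    · have h1 := val_eq_two hval hst ha hab r1 r2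
      have h2 := val_eq_two hval hst hb hab.symm r2 r1
      rcases hall x rfl with rfl | rfl <;> simp [r1, r2, h1, h2]
    · obtain ⟨hv, hv'⟩ := val_cases hval hst hd ha hb had hbd hcyc
      rcases hcyc with ⟨r1, r2, r3⟩ | ⟨r1, r2, r3⟩ <;> rcases hv' with ⟨e1, e2⟩ | ⟨e1, e2⟩ <;>
        rcases hall x rfl with rfl | rfl | rfl <;>
        simp [r1, r2, r3, hv, e1, e2, had, hbd, hbd.symm]
  obtain ⟨Y, hY⟩ := hZ.exists_face_function hG hdeg (χ := fun e => if val e = 1 then 1 else 0)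
    (q := fun x => if G.cornerColor val x = 3 then 1 else 0) hrot (by
      intro x _
      simp only [hZ.cornerColor_eq_three hG hdeg hval hst, rev_fst]
      by_cases hx : val x.1 = 1
      · rw [← (partner_stable hval hst hx).2.1]
        cases h : x.2 <;> cases h' : (G.rot x).2 <;> simp [hx, h]
      · simp [hx])
  refine ⟨Y, hY, fun x => ?_⟩
  rw [hY, hY]
  exact rev_add_of_face_function hG (χ := fun e => if val e = 1 then 1 else 0) hrot hY x

/-- If there is a Hamiltonian cycle, then the faces can be colored. -/
theorem IsTour.exists_color (hZ : G.IsTour Z) (hG : G.IsPlane) (hdeg : G.MaxDegreeLE 3)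
    (hval : Agrees val Z) (hst : G.Stable val) :
    (∃ c : Fin f → ℕ, ∀ d, c (G.left d) = G.cornerColor val d) ∧ G.ColorsMatch val := by
  classical
  obtain ⟨σ, hσ⟩ := hZ.exists_side hG hdeg
  obtain ⟨Y, hY, hY'⟩ := hZ.exists_yellow hG hdeg hval hst
  -- Yellow takes precedence; the other faces are white to the left of the tour (`σ = 1`) and blue
  -- to its right.
  have hc : ∀ d, (if Y (G.left d) = 1 then 3 else if σ (G.left d) = 1 then 2 else 1) =
      G.cornerColor val d := by
    intro d
    have h3 := hZ.cornerColor_eq_three hG hdeg hval hst d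
    rw [hY, hσ]
    by_cases hd : G.cornerColor val d = 3
    · simp [hd]
    · simp only [hd, if_false, zero_ne_one]
      rw [← not_iff_not] at h3
      have h3 := h3.1 hd
      obtain ⟨hle, h0, h2⟩ := hval d.1
      unfold cornerColor at hd ⊢
      unfold tourSide
      by_cases e0 : val d.1 = 0
      · cases (G.rot d).2 <;> simp [e0, h0 e0]
      · have hd' : ¬ (if val (G.rot d).1 = 0 then G.rot (G.rot d) else G.rot d).2 = d.2 := by
          intro h
          simp [e0, h] at hd
        simp only [e0, hd', if_false]
        by_cases hdZ : d.1 ∈ Z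
        · cases d.2 <;> simp [hdZ]
        -- An off-tour edge that is not deleted is undecided; as the corner is not yellow, the next
        -- dart has the opposite direction, and the side can be read from `d` itself.
        · have hne : (G.rot d).2 ≠ d.2 := fun h => h3 ⟨by
            have : val d.1 ≠ 2 := fun h => hdZ (h2 h)
            omega, h⟩
          cases e1 : d.2 <;> cases e2 : (G.rot d).2 <;> simp_all
  refine ⟨⟨fun x => if Y x = 1 then 3 else if σ x = 1 then 2 else 1, hc⟩, fun d => ?_⟩
  have hy := hY' d
  have hs := hZ.tourSide_rev hG hdeg d
  rw [← hσ, ← hσ] at hs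
  rw [← hc d, ← hc (rev d)]
  obtain ⟨hle, h0, h2⟩ := hval d.1
  have key : ∀ y y' s s' : ZMod 2,
      ((if y = 1 then 3 else if s = 1 then 2 else 1) =
        (if y' = 1 then 3 else if s' = 1 then 2 else 1)) ↔
      (y' + y = 0 ∧ (y = 1 ∨ s' + s = 0)) := by decide
  rw [key, hy, hs]
  have hv : val d.1 = 0 ∨ val d.1 = 1 ∨ val d.1 = 2 := by omega
  rcases hv with hv | hv | hv
  · simp [hv, h0 hv]
  · simp [hv]
  · have : G.cornerColor val d ≠ 3 := by
      rw [Ne, hZ.cornerColor_eq_three hG hdeg hval hst]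
      simp [hv]
    simp [hv, h2 hv, hY, this]

/-! ### From consistent corner colors to a coloring of the subgraph; no tour is used. -/

/-- Every dart skipped between `d` and `d'` is deleted, so the faces on its two sides are merged and
the whole sector lies in one face of the subgraph. -/
theorem IsPlane.subLeft_eq_of_nextAround (hG : G.IsPlane) {S : Set (Fin m)}
    {d d' : Fin m × Bool} (h : G.NextAround S d d') : G.subLeft S (rev d') = G.subLeft S d := by
  have hrev : ∀ x : Fin m × Bool, x.1 ∉ S → G.subLeft S (rev x) = G.subLeft S x := by
    rintro ⟨e, b⟩ hx
    have : G.subLeft S (e, true) = G.subLeft S (e, false) := Quot.sound ⟨e, hx, rfl, rfl⟩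
    cases b
    · exact this
    · exact this.symm
  have hrot : ∀ x, G.subLeft S (rev (G.rot x)) = G.subLeft S x := fun x =>
    congrArg (Quot.mk _) (hG.left_rot x)
  obtain ⟨-, k, hk, rfl, hj⟩ := h
  have key : ∀ j < k, G.subLeft S (rev ((G.rot ^ (j + 1)) d)) = G.subLeft S d := by
    intro j
    induction j with
    | zero => intro _; simp [hrot]
    | succ j ih =>
      intro hjk
      rw [← ih (by omega), hrev _ (hj (j + 1) (by omega) hjk), pow_succ' _ (j + 1),
        Equiv.Perm.mul_apply, hrot]
  have := key (k - 1) (by omega)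
  rwa [Nat.sub_add_cancel hk] at this

/-- The face color with a given number. -/
def faceColor (k : ℕ) : FaceColor :=
  if k = 1 then .blue else if k = 2 then .white else .yellow

/-- A consistent coloring of the faces is as required. -/
theorem IsPlane.exists_isOrientationColoring (hG : G.IsPlane) (hdeg : G.MaxDegreeLE 3)
    {c : Fin f → ℕ} (hc : ∀ d, c (G.left d) = G.cornerColor val d) (hm : G.ColorsMatch val) :
    ∃ c : G.SubFace {e | val e ≠ 0} → FaceColor,
      G.IsOrientationColoring {e | val e ≠ 0} c := by
  have hcases : ∀ d, G.cornerColor val d = 1 ∨ G.cornerColor val d = 2 ∨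
      G.cornerColor val d = 3 := by
    intro d
    unfold cornerColor
    split_ifs <;> simp
  -- Colors agree across deleted edges, so they descend to the merged faces.
  let c' : G.SubFace {e | val e ≠ 0} → FaceColor := Quot.lift (fun x => faceColor (c x)) (by
    rintro _ _ ⟨e, he, rfl, rfl⟩
    have : G.cornerColor val (e, true) = G.cornerColor val (e, false) :=
      (hm (e, true)).2 (by simpa using he)
    simp only [hc, this])
  have hc' : ∀ d, c' (G.subLeft _ d) = faceColor (G.cornerColor val d) := fun d => by
    rw [← hc]; rfl
  refine ⟨c', ?_, ?_, ?_, ?_⟩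
  · intro e he h
    have hne : G.cornerColor val (e, true) ≠ G.cornerColor val (e, false) := fun h =>
      he ((hm (e, true)).1 h)
    rw [hc', hc'] at h
    rcases hcases (e, true) with h1 | h1 | h1 <;> rcases hcases (e, false) with h2 | h2 | h2 <;>
      simp [h1, h2, faceColor] at h hne
  · intro d hd h
    rw [hc'] at h
    have h1 : G.cornerColor val d = 1 := by
      rcases hcases d with h1 | h1 | h1 <;> simp [h1, faceColor] at h ⊢
    have hd' : val d.1 ≠ 0 := hd
    cases h2 : d.2 <;> grind [cornerColor]
  · intro d hd h
    rw [hc'] at h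
    have h1 : G.cornerColor val d = 2 := by
      rcases hcases d with h1 | h1 | h1 <;> simp [h1, faceColor] at h ⊢
    have hd' : val d.1 ≠ 0 := hd
    cases h2 : d.2 <;> grind [cornerColor]
  · rintro d d' ⟨hd, hd', hnext⟩ h
    have hsub := hG.subLeft_eq_of_nextAround hnext
    rw [rev_rev] at hsub
    rw [hsub, hc'] at h
    have h1 : G.cornerColor val d' = 3 := by
      rcases hcases d' with h1 | h1 | h1 <;> simp [h1, faceColor] at h ⊢
    have hd0 : val d.1 ≠ 0 := hd
    have hd0' : val d'.1 ≠ 0 := hd'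
    suffices hs : (rev d).2 = d'.2 by
      rw [← hs]; simp
    simp only [cornerColor, hd0', if_false] at h1
    -- By the degree bound the next kept dart is one, two or three steps away. `cornerColor` skips
    -- at most one deleted dart; if two are deleted, the third step returns to `d'`, and the
    -- directions agree trivially.
    obtain ⟨-, k, hk, hkd, hj⟩ := hnext
    by_cases e1 : val (G.rot d').1 = 0
    · have k1 : k ≠ 1 := by rintro rfl; simp at hkd; rw [hkd] at e1; exact hd0 e1
      by_cases e2 : val (G.rot (G.rot d')).1 = 0
      · have k2 : k ≠ 2 := by rintro rfl; simp [pow_succ] at hkd; rw [hkd] at e2; exact hd0 e2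
        have n1 : G.rot d' ≠ d' := fun h => hd0' (h ▸ e1)
        have n2 : G.rot (G.rot d') ≠ d' := fun h => hd0' (h ▸ e2)
        have n3 := G.rot.injective.ne n1
        have h3 : G.rot (G.rot (G.rot d')) = d' := by
          have := hdeg.eq_or_eq_or_eq n1.symm n2.symm n3.symm (hG.vert_rot _)
            (by rw [hG.vert_rot, hG.vert_rot])
            (show G.vert (G.rot (G.rot (G.rot d'))) = G.vert d' by simp only [hG.vert_rot])
          rcases this with h | h | h
          · exact h
          · exact absurd (G.rot.injective h) n2
          · exact absurd (G.rot.injective (G.rot.injective h)) n1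
        have k3 : ¬ 3 < k := fun h => by
          have := hj 3 (by omega) h
          simp [pow_succ, h3] at this
          exact hd0' this
        obtain rfl : k = 3 := by omega
        simp [pow_succ, h3] at hkd
        rw [← hkd]
      · have k2 : ¬ 2 < k := fun h => by
          have := hj 2 (by omega) h
          simp [pow_succ] at this
          exact e2 this
        obtain rfl : k = 2 := by omega
        simp [pow_succ] at hkd
        grind
    · have k1 : ¬ 1 < k := fun h => by
        have := hj 1 (by omega) h
        simp at this
        exact e1 this
      obtain rfl : k = 1 := by omega
      simp at hkd
      grind

end EmbeddedDigraph

/-! ### The program. -/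

namespace Ram

/-- An expression that vanishes if and only if the two given ones have the same value. -/
def Expr.dist (a b : Expr) : Expr := .add (.sub a b) (.sub b a)

@[simp] theorem Expr.eval_dist (s : State) (a b : Expr) :
    (a.dist b).eval s = 0 ↔ a.eval s = b.eval s := by
  simp only [dist, eval]
  omega

namespace HamiltonianReduction

/-- Fills in the tables of the rotation (`10`), of the faces to the left (`11`), of the edges
(`12`), of the directions (`13`) and of the reversals (`14`) of the darts, and declares all edges
undecided (`7`). -/
def setupStep : Code :=
  .cond (.sub (.reg 1) (.reg 3))
    (.seq (.store 10 (.reg 3) (.get 2 (.reg 3)))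
    (.seq (.store 11 (.reg 3) (.get 4 (.reg 3)))
    (.seq (.store 12 (.reg 3) (.reg 3))
    (.seq (.store 13 (.reg 3) (.lit 1))
    (.seq (.store 14 (.reg 3) (.add (.reg 1) (.reg 3)))
      (.store 7 (.reg 3) (.lit 1)))))))
    (.seq (.store 10 (.reg 3) (.get 3 (.sub (.reg 3) (.reg 1))))
    (.seq (.store 11 (.reg 3) (.get 5 (.sub (.reg 3) (.reg 1))))
    (.seq (.store 12 (.reg 3) (.sub (.reg 3) (.reg 1)))
    (.seq (.store 13 (.reg 3) (.lit 0))
      (.store 14 (.reg 3) (.sub (.reg 3) (.reg 1)))))))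

/-- The dart after the current one. -/
def nextDart : Expr := .get 10 (.reg 3)

/-- Tabulates the partner of the current dart in the array `15`. -/
def partnerStep : Code :=
  .cond (.dist (.get 13 nextDart) (.get 13 (.reg 3)))
    (.cond (.dist (.get 13 (.get 10 nextDart)) (.get 13 (.reg 3)))
      (.store 15 (.reg 3) (.reg 3))
      (.store 15 (.reg 3) (.get 10 nextDart)))
    (.store 15 (.reg 3) nextDart)

/-- The edge of the current dart. -/
def curEdge : Expr := .get 12 (.reg 3)

/-- Decides the edge of the current dart, if possible. -/
def deduceStep : Code :=
  .cond (.dist (.get 7 curEdge) (.lit 1)) .skip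
    (.cond (.dist (.get 15 (.reg 3)) (.reg 3))
      (.cond (.dist (.get 13 nextDart) (.get 13 (.get 10 (.get 14 (.reg 3)))))
        (.store 7 curEdge (.lit 2))
        (.store 7 curEdge (.sub (.lit 2) (.get 7 (.get 12 (.get 15 (.reg 3)))))))
      (.store 7 curEdge (.lit 2)))

/-- Writes the color of the corner at a decided edge whose successor in the subgraph is `e`. -/
def colorAt (e : Expr) : Code :=
  .cond (.dist (.get 13 e) (.get 13 (.reg 3)))
    (.store 16 (.reg 3) (.add (.lit 1) (.get 13 (.reg 3))))
    (.store 16 (.reg 3) (.lit 3))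

/-- Tabulates the colors of the corners (`16`) and of the faces (`17`). -/
def colorStep : Code :=
  .seq
    (.cond (.get 7 curEdge)
      (.cond (.get 7 (.get 12 nextDart)) (colorAt nextDart) (colorAt (.get 10 nextDart)))
      (.store 16 (.reg 3) (.sub (.lit 2) (.get 13 nextDart))))
    (.store 17 (.get 11 (.reg 3)) (.get 16 (.reg 3)))

/-- Sets the answer to `0` if the colors at the current dart are inconsistent. -/
def checkStep : Code :=
  .seq
    (.cond (.dist (.get 17 (.get 11 (.reg 3))) (.get 16 (.reg 3))) (.assign 0 (.lit 0)) .skip)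
    (.cond (.get 7 curEdge)
      (.cond (.dist (.get 16 (.reg 3)) (.get 16 (.get 14 (.reg 3)))) .skip (.assign 0 (.lit 0)))
      (.cond (.dist (.get 16 (.reg 3)) (.get 16 (.get 14 (.reg 3)))) (.assign 0 (.lit 0)) .skip))

/-- The whole algorithm. -/
def algorithm : Code :=
  .seq (.count 3 setupStep)
  (.seq (.count 3 partnerStep)
  (.seq (.count 4 (.count 3 deduceStep))
  (.seq (.count 3 colorStep)
  (.seq (.assign 0 (.lit 1))
    (.count 3 checkStep)))))

end HamiltonianReduction

end Ram

/-! ### Correctness of the program. -/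

namespace EmbeddedDigraph

open Ram Ram.HamiltonianReduction

variable {n m f : ℕ} {G : EmbeddedDigraph n m f} {val : Fin m → ℕ}

theorem dartCode_lt (d : Fin m × Bool) : dartCode d < m + m := by
  unfold dartCode
  split <;> omega

theorem dartCode_injective : Function.Injective (dartCode (m := m)) := by
  rintro ⟨e, b⟩ ⟨e', b'⟩ h
  cases b <;> cases b' <;> simp [dartCode] at h ⊢ <;> omega

@[simp] theorem dartCode_inj {d d' : Fin m × Bool} : dartCode d = dartCode d' ↔ d = d' :=
  dartCode_injective.eq_iff

theorem exists_dartCode_eq {k : ℕ} (hk : k < m + m) : ∃ d : Fin m × Bool, dartCode d = k := by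
  by_cases h : k < m
  · exact ⟨(⟨k, h⟩, true), by simp [dartCode]⟩
  · exact ⟨(⟨k - m, by omega⟩, false), by simp [dartCode]; omega⟩

theorem forall_dartCode_lt_succ {p : Fin m × Bool → Prop} {d : Fin m × Bool} (hd : p d)
    (h : ∀ d', dartCode d' < dartCode d → p d') (d' : Fin m × Bool)
    (hd' : dartCode d' < dartCode d + 1) : p d' := by
  rcases Nat.lt_succ_iff_lt_or_eq.1 hd' with h' | h'
  · exact h d' h'
  · rwa [dartCode_inj.1 h']

/-- The tables contain the data of the dart `d`. -/
structure TableEntry (G : EmbeddedDigraph n m f) (s : State) (d : Fin m × Bool) : Prop where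
  rot : s.arr 10 (dartCode d) = dartCode (G.rot d)
  left : s.arr 11 (dartCode d) = G.left d
  edge : s.arr 12 (dartCode d) = d.1
  dir : s.arr 13 (dartCode d) = if d.2 then 1 else 0
  rev : s.arr 14 (dartCode d) = dartCode (rev d)

/-- The rule for loops over the darts. -/
theorem eval_count_darts {x : ℕ} {P : Code} (hx : ¬ P.Writes x) (I : ℕ → State → Prop)
    (s : State) (hm : s.reg 1 = m) (h0 : I 0 (s.setReg x 0))
    (hstep : ∀ (d : Fin m × Bool) r, r.reg x = dartCode d → I (dartCode d) r →
      I (dartCode d + 1) ((P.eval r).setReg x (dartCode d + 1))) :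
    I (m + m) ((Code.count x P).eval s) := by
  refine Code.eval_count_induction hx I s (by rw [hm]) h0 fun k hk r hr hI => ?_
  obtain ⟨d, rfl⟩ := exists_dartCode_eq hk
  exact hstep d r hr hI

theorem eval_setup (G : EmbeddedDigraph n m f) (s : State) (hs : s = G.input) :
    ((Code.count 3 setupStep).eval s).reg 1 = m ∧
    (∀ d, TableEntry G ((Code.count 3 setupStep).eval s) d) ∧
    ∀ e : Fin m, ((Code.count 3 setupStep).eval s).arr 7 e = 1 := by
  have key := eval_count_darts (m := m) (x := 3) (P := setupStep)
    (by simp [setupStep, Code.Writes])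
    (fun k r => r.reg 1 = m ∧ (∀ a < 6, r.arr a = G.input.arr a) ∧
      ∀ d, dartCode d < k → TableEntry G r d ∧ (d.2 = true → r.arr 7 d.1 = 1)) s
    (by rw [hs]; rfl)
    ⟨by subst hs; simp [input], by subst hs; simp, by simp⟩ (by
      rintro d r hr ⟨h1, hin, hI⟩
      obtain ⟨e, b⟩ := d
      have hne : ∀ d' : Fin m × Bool, dartCode d' < dartCode (e, b) → dartCode d' ≠ dartCode (e, b) :=
        fun _ => Nat.ne_of_lt
      -- Array `7` is indexed by edges rather than darts; it is written at tail darts only, whose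
      -- code is the edge itself.
      have hne' : ∀ d' : Fin m × Bool, d'.2 = true → dartCode d' < dartCode (e, true) →
          (d'.1 : ℕ) ≠ e := fun d' hb hd' => by
        simp only [dartCode, hb, if_true] at hd'
        omega
      have h2 := hin 2 (by simp)
      have h3 := hin 3 (by simp)
      have h4 := hin 4 (by simp)
      have h5 := hin 5 (by simp)
      have he := e.isLt
      cases b
      · have hc : dartCode (e, false) = m + e := rfl
        have heval : setupStep.eval r = ((((r.setArr 10 (m + e) (dartCode (G.rot (e, false)))).setArr
            11 (m + e) (G.left (e, false))).setArr 12 (m + e) e).setArr 13 (m + e) 0).setArr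
            14 (m + e) e := by
          simp [setupStep, Code.eval, Expr.eval, hr, hc, h1, h3, h5, input, table]
        rw [heval]
        refine ⟨by simp [h1], fun a ha => ?_, forall_dartCode_lt_succ ?_ fun d' hd' => ?_⟩
        · rw [← hin a ha]
          ext j
          have h10 : a ≠ 10 := by omega
          have h11 : a ≠ 11 := by omega
          have h12 : a ≠ 12 := by omega
          have h13 : a ≠ 13 := by omega
          have h14 : a ≠ 14 := by omega
          simp [h10, h11, h12, h13, h14]
        · exact ⟨⟨by simp [hc], by simp [hc], by simp [hc], by simp [hc], by
            simp [rev, dartCode]⟩, by simp⟩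
        · obtain ⟨ht, h7⟩ := hI d' hd'
          have := hne d' hd'
          rw [hc] at this
          exact ⟨⟨by simp [this, ht.rot], by simp [this, ht.left], by simp [this, ht.edge],
            by simp [this, ht.dir], by simp [this, ht.rev]⟩, by simpa using h7⟩
      · have hc : dartCode (e, true) = e := rfl
        have heval : setupStep.eval r = (((((r.setArr 10 e (dartCode (G.rot (e, true)))).setArr
            11 e (G.left (e, true))).setArr 12 e e).setArr 13 e 1).setArr
            14 e (m + e)).setArr 7 e 1 := by
          have : m - e ≠ 0 := by omega
          simp [setupStep, Code.eval, Expr.eval, hr, hc, h1, h2, h4, input, table, this]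
        rw [heval]
        refine ⟨by simp [h1], fun a ha => ?_, forall_dartCode_lt_succ ?_ fun d' hd' => ?_⟩
        · rw [← hin a ha]
          ext j
          have h10 : a ≠ 10 := by omega
          have h11 : a ≠ 11 := by omega
          have h12 : a ≠ 12 := by omega
          have h13 : a ≠ 13 := by omega
          have h14 : a ≠ 14 := by omega
          have h7 : a ≠ 7 := by omega
          simp [h10, h11, h12, h13, h14, h7]
        · exact ⟨⟨by simp [hc], by simp [hc], by simp [hc], by simp [hc], by
            simp [rev, dartCode]⟩, by simp⟩
        · obtain ⟨ht, h7⟩ := hI d' hd'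
          have := hne d' hd'
          rw [hc] at this
          refine ⟨⟨by simp [this, ht.rot], by simp [this, ht.left], by simp [this, ht.edge],
            by simp [this, ht.dir], by simp [this, ht.rev]⟩, fun hb => ?_⟩
          simpa [hne' d' hb hd'] using h7 hb)
  refine ⟨key.1, fun d => (key.2.2 d (dartCode_lt d)).1, fun e => ?_⟩
  exact (key.2.2 (e, true) (dartCode_lt _)).2 rfl

/-- The tables are filled in and the array `7` holds `val`. -/
structure Ready (G : EmbeddedDigraph n m f) (val : Fin m → ℕ) (s : State) : Prop where
  edges : s.reg 1 = m
  table : ∀ d, TableEntry G s d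
  val : ∀ e : Fin m, s.arr 7 e = val e

theorem Ready.setReg {s : State} (h : G.Ready val s) {x : ℕ} (hx : x ≠ 1) (v : ℕ) :
    G.Ready val (s.setReg x v) := by
  refine ⟨by simp [hx.symm, h.edges], fun d => ⟨?_, ?_, ?_, ?_, ?_⟩, h.val⟩
  exacts [(h.table d).rot, (h.table d).left, (h.table d).edge, (h.table d).dir, (h.table d).rev]

theorem Ready.setArr {s : State} (h : G.Ready val s) {a : ℕ} (ha : 14 < a) (i v : ℕ) :
    G.Ready val (s.setArr a i v) := by
  have h7 : 7 ≠ a := by omega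
  have h10 : 10 ≠ a := by omega
  have h11 : 11 ≠ a := by omega
  have h12 : 12 ≠ a := by omega
  have h13 : 13 ≠ a := by omega
  have h14 : 14 ≠ a := by omega
  refine ⟨h.edges, fun d => ⟨?_, ?_, ?_, ?_, ?_⟩, ?_⟩
  · simpa [h10] using (h.table d).rot
  · simpa [h11] using (h.table d).left
  · simpa [h12] using (h.table d).edge
  · simpa [h13] using (h.table d).dir
  · simpa [h14] using (h.table d).rev
  · simpa [h7] using h.val

theorem Ready.setVal {s : State} (h : G.Ready val s) (e : Fin m) (v : ℕ) :
    G.Ready (Function.update val e v) (s.setArr 7 e v) := by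
  refine ⟨h.edges, fun d => ⟨?_, ?_, ?_, ?_, ?_⟩, ?_⟩
  · simpa using (h.table d).rot
  · simpa using (h.table d).left
  · simpa using (h.table d).edge
  · simpa using (h.table d).dir
  · simpa using (h.table d).rev
  · intro e'
    simp [Function.update_apply, Fin.val_inj, h.val]

@[simp] theorem ite_dir_eq (b c : Bool) :
    ((if b then 1 else 0 : ℕ) = if c then 1 else 0) ↔ b = c := by
  cases b <;> cases c <;> simp

/-- The array `15` holds the partners. -/
def HasPartners (G : EmbeddedDigraph n m f) (s : State) : Prop :=
  ∀ d, s.arr 15 (dartCode d) = dartCode (G.partner d)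

theorem Ready.eval_partner {s : State} (h : G.Ready val s) :
    G.Ready val ((Code.count 3 partnerStep).eval s) ∧
      G.HasPartners ((Code.count 3 partnerStep).eval s) := by
  have key := eval_count_darts (m := m) (x := 3) (P := partnerStep)
    (by simp [partnerStep, Code.Writes])
    (fun k r => G.Ready val r ∧
      ∀ d, dartCode d < k → r.arr 15 (dartCode d) = dartCode (G.partner d)) s h.edges
    ⟨h.setReg (by simp) _, by simp⟩ (by
      rintro d r hr ⟨hR, hI⟩
      have heval : partnerStep.eval r = r.setArr 15 (dartCode d) (dartCode (G.partner d)) := by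
        simp only [partnerStep, Code.eval, Expr.eval_dist, nextDart, Expr.eval, hr,
          (hR.table _).rot, (hR.table _).dir, ite_dir_eq, partner]
        split_ifs <;> rfl
      rw [heval]
      refine ⟨(hR.setArr (by simp) _ _).setReg (by simp) _,
        forall_dartCode_lt_succ (by simp) fun d' hd' => ?_⟩
      have : d' ≠ d := by rintro rfl; simp at hd'
      simp [this, hI d' hd'])
  exact ⟨key.1, fun d => key.2 d (dartCode_lt d)⟩

/-- The values after an attempt to decide the edge of `d`. -/
def decideEdge (G : EmbeddedDigraph n m f) (val : Fin m → ℕ) (d : Fin m × Bool) : Fin m → ℕ :=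
  if val d.1 = 1 then Function.update val d.1 (G.deduced val d) else val

/-- The number of undecided edges. -/
def undecided (val : Fin m → ℕ) : ℕ := (Finset.univ.filter fun e => val e = 1).card

/-- The progress measure: either nothing changes at `d`, or an undecided edge gets decided, which
also witnesses that the values were not stable. -/
theorem decideEdge_cases (val : Fin m → ℕ) (d : Fin m × Bool) :
    (G.decideEdge val d = val ∧ (val d.1 = 1 → G.deduced val d = 1)) ∨
      (undecided (G.decideEdge val d) < undecided val ∧ ¬ G.Stable val) := by
  by_cases h : val d.1 = 1
  · by_cases h' : G.deduced val d = 1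
    · left
      refine ⟨?_, fun _ => h'⟩
      rw [decideEdge, if_pos h, h', ← h, Function.update_eq_self]
    · right
      refine ⟨Finset.card_lt_card ?_, fun hst => h' (hst d h)⟩
      rw [decideEdge, if_pos h, Finset.ssubset_iff_of_subset]
      · exact ⟨d.1, by simp [h], by simp [h']⟩
      · intro e
        simp only [Finset.mem_filter, Finset.mem_univ, true_and, Function.update_apply]
        split
        · exact fun h0 => absurd h0 h'
        · exact id
  · left
    simp [decideEdge, h]

/-- The edges decided by `val` are decided correctly for all Hamiltonian cycles. -/
def Sound (G : EmbeddedDigraph n m f) (val : Fin m → ℕ) : Prop :=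
  ∀ Z, G.IsTour Z → Agrees val Z

theorem Sound.decideEdge (hG : G.IsPlane) (hdeg : G.MaxDegreeLE 3) (h : G.Sound val)
    (d : Fin m × Bool) : G.Sound (G.decideEdge val d) := by
  intro Z hZ e
  have hd := hZ.deduced_correct hG hdeg (h Z hZ) d
  unfold EmbeddedDigraph.decideEdge
  split
  · rw [Function.update_apply]
    split
    · next h => rwa [h]
    · exact h Z hZ e
  · exact h Z hZ e

theorem Ready.eval_deduceStep {s : State} (h : G.Ready val s) (hp : G.HasPartners s)
    {d : Fin m × Bool} (hd : s.reg 3 = dartCode d) :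
    G.Ready (G.decideEdge val d) (deduceStep.eval s) ∧ G.HasPartners (deduceStep.eval s) := by
  have heval : deduceStep.eval s =
      if val d.1 = 1 then s.setArr 7 d.1 (G.deduced val d) else s := by
    simp only [deduceStep, Code.eval, Expr.eval_dist, nextDart, curEdge, Expr.eval, hd,
      (h.table _).rot, (h.table _).dir, (h.table _).edge, (h.table _).rev, hp _, h.val,
      dartCode_inj, ite_dir_eq, deduced]
    split_ifs <;> first | rfl | simp_all
  rw [heval, EmbeddedDigraph.decideEdge]
  split
  · exact ⟨h.setVal _ _, fun d' => by simpa using hp d'⟩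
  · exact ⟨h, hp⟩

/-- As long as nothing has changed, each dart passed was tested against the original values, so a
pass without change proves them stable. -/
theorem Ready.eval_deduce {s : State} (hG : G.IsPlane) (hdeg : G.MaxDegreeLE 3)
    (h : G.Ready val s) (hp : G.HasPartners s) (hs : G.Sound val) :
    ∃ val', G.Ready val' ((Code.count 3 deduceStep).eval s) ∧
      G.HasPartners ((Code.count 3 deduceStep).eval s) ∧ G.Sound val' ∧
      ((val' = val ∧ G.Stable val) ∨ (undecided val' < undecided val ∧ ¬ G.Stable val)) := by
  obtain ⟨val', h1, h2, h3, h4⟩ := eval_count_darts (m := m) (x := 3) (P := deduceStep)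
    (by simp [deduceStep, Code.Writes])
    (fun k r => ∃ val', G.Ready val' r ∧ G.HasPartners r ∧ G.Sound val' ∧
      ((val' = val ∧ ∀ d, dartCode d < k → val d.1 = 1 → G.deduced val d = 1) ∨
        (undecided val' < undecided val ∧ ¬ G.Stable val))) s h.edges
    ⟨val, h.setReg (by simp) _, hp, hs, .inl ⟨rfl, by simp⟩⟩ (by
      rintro d r hr ⟨val', h1, h2, h3, h4⟩
      obtain ⟨h5, h6⟩ := h1.eval_deduceStep h2 hr
      refine ⟨_, h5.setReg (by simp) _, h6, h3.decideEdge hG hdeg d, ?_⟩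
      rcases h4 with ⟨rfl, h4⟩ | ⟨h4, h7⟩
      · rcases decideEdge_cases (G := G) val' d with ⟨h8, h9⟩ | h8
        · exact .inl ⟨h8, forall_dartCode_lt_succ h9 h4⟩
        · exact .inr h8
      · right
        refine ⟨?_, h7⟩
        rcases decideEdge_cases (G := G) val' d with ⟨h8, -⟩ | ⟨h8, -⟩
        · rwa [h8]
        · exact h8.trans h4)
  refine ⟨val', h1, h2, h3, ?_⟩
  rcases h4 with ⟨h4, h5⟩ | h4
  · exact .inl ⟨h4, fun d => h5 d (dartCode_lt d)⟩
  · exact .inr h4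

theorem Ready.eval_rounds {s : State} (hG : G.IsPlane) (hdeg : G.MaxDegreeLE 3)
    (h : G.Ready val s) (hp : G.HasPartners s) (hs : G.Sound val) :
    ∃ val', G.Ready val' ((Code.count 4 (.count 3 deduceStep)).eval s) ∧
      G.Sound val' ∧ G.Stable val' := by
  obtain ⟨val', h1, -, h3, h4⟩ := Code.eval_count_induction (x := 4) (P := .count 3 deduceStep)
    (by simp [deduceStep, Code.Writes])
    (fun k r => ∃ val', G.Ready val' r ∧ G.HasPartners r ∧ G.Sound val' ∧
      (G.Stable val' ∨ undecided val' + k ≤ m)) s (by rw [h.edges])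
    ⟨val, h.setReg (by simp) _, hp, hs, .inr (by
      simpa [undecided] using Finset.card_le_univ (Finset.univ.filter fun e => val e = 1))⟩ (by
      rintro k - r - ⟨val', h1, h2, h3, h4⟩
      obtain ⟨val'', h5, h6, h7, h8⟩ := h1.eval_deduce hG hdeg h2 h3
      refine ⟨val'', h5.setReg (by simp) _, h6, h7, ?_⟩
      rcases h8 with ⟨rfl, h8⟩ | ⟨h8, h9⟩
      · exact .inl h8
      · have := h4.resolve_left h9
        exact .inr (by omega))
  -- Without stability, each of the `2 * m` rounds would have decided an edge, although there are
  -- only `m`. If `m = 0`, stability is vacuous.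
  refine ⟨val', h1, h3, h4.elim id fun h => ?_⟩
  intro d
  have := d.1.pos
  omega

theorem Ready.eval_colorStep {s : State} (h : G.Ready val s)
    {d : Fin m × Bool} (hd : s.reg 3 = dartCode d) :
    colorStep.eval s = (s.setArr 16 (dartCode d) (G.cornerColor val d)).setArr 17 (G.left d)
      (G.cornerColor val d) := by
  have heval : ((Code.cond (.get 7 curEdge)
      (.cond (.get 7 (.get 12 nextDart)) (colorAt nextDart) (colorAt (.get 10 nextDart)))
      (.store 16 (.reg 3) (.sub (.lit 2) (.get 13 nextDart)))).eval s) =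
      s.setArr 16 (dartCode d) (G.cornerColor val d) := by
    simp only [colorAt, Code.eval, Expr.eval_dist, nextDart, curEdge, Expr.eval, hd,
      (h.table _).rot, (h.table _).dir, (h.table _).edge, h.val, ite_dir_eq, cornerColor]
    split_ifs <;> simp_all
  rw [colorStep, Code.eval, heval]
  simp [Code.eval, Expr.eval, hd, (h.table d).left]

/-- Each dart overwrites the color of the face to its left. If any consistent coloring `c` exists,
all these writes agree with it, so testing the single table `17` decides whether one exists. -/
theorem Ready.eval_color {s : State} (h : G.Ready val s) :
    G.Ready val ((Code.count 3 colorStep).eval s) ∧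
      (∀ d, ((Code.count 3 colorStep).eval s).arr 16 (dartCode d) = G.cornerColor val d) ∧
      ∀ c : Fin f → ℕ, (∀ d, c (G.left d) = G.cornerColor val d) →
        ∀ d, ((Code.count 3 colorStep).eval s).arr 17 (G.left d) = G.cornerColor val d := by
  have key := eval_count_darts (m := m) (x := 3) (P := colorStep)
    (by simp [colorStep, colorAt, Code.Writes])
    (fun k r => G.Ready val r ∧
      (∀ d, dartCode d < k → r.arr 16 (dartCode d) = G.cornerColor val d) ∧
      ∀ c : Fin f → ℕ, (∀ d, c (G.left d) = G.cornerColor val d) →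
        ∀ d, dartCode d < k → r.arr 17 (G.left d) = G.cornerColor val d) s h.edges
    ⟨h.setReg (by simp) _, by simp, by simp⟩ (by
      rintro d r hr ⟨hR, h1, h2⟩
      rw [hR.eval_colorStep hr]
      refine ⟨((hR.setArr (by simp) _ _).setArr (by simp) _ _).setReg (by simp) _,
        forall_dartCode_lt_succ (by simp) fun d' hd' => ?_,
        fun c hc => forall_dartCode_lt_succ (by simp) fun d' hd' => ?_⟩
      · have : d' ≠ d := by rintro rfl; simp at hd'
        simp [this, h1 d' hd']
      · by_cases hl : G.left d' = G.left d
        · simp [hl, ← hc]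
        · simp [Fin.val_inj, hl, h2 c hc d' hd'])
  exact ⟨key.1, fun d => key.2.1 d (dartCode_lt d), fun c hc d => key.2.2 c hc d (dartCode_lt d)⟩

open Classical in
theorem Ready.eval_check {s : State} (h : G.Ready val s) (h0 : s.reg 0 = 1)
    (h16 : ∀ d, s.arr 16 (dartCode d) = G.cornerColor val d) :
    ((Code.count 3 checkStep).eval s).arr = s.arr ∧
      (((Code.count 3 checkStep).eval s).reg 0 ≠ 0 ↔
        (∀ d, s.arr 17 (G.left d) = G.cornerColor val d) ∧ G.ColorsMatch val) := by
  have key := eval_count_darts (m := m) (x := 3) (P := checkStep)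
    (by simp [checkStep, Code.Writes])
    (fun k r => G.Ready val r ∧ r.arr = s.arr ∧ (r.reg 0 ≠ 0 ↔
      ∀ d, dartCode d < k → s.arr 17 (G.left d) = G.cornerColor val d ∧
        (G.cornerColor val d = G.cornerColor val (rev d) ↔ val d.1 = 0))) s h.edges
    ⟨h.setReg (by simp) _, rfl, by simp [h0]⟩ (by
      rintro d r hr ⟨hR, ha, hI⟩
      have heval : checkStep.eval r =
          if s.arr 17 (G.left d) = G.cornerColor val d ∧
            (G.cornerColor val d = G.cornerColor val (rev d) ↔ val d.1 = 0)
          then r else r.setReg 0 0 := by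
        have f1 := (hR.table d).left
        have f2 := (hR.table d).edge
        have f3 := (hR.table d).rev
        have f4 : r.arr 16 (dartCode d) = G.cornerColor val d := by rw [ha, h16]
        have f5 : r.arr 16 (dartCode (rev d)) = G.cornerColor val (rev d) := by rw [ha, h16]
        have f6 := hR.val d.1
        have hr0 : (r.setReg 0 0).setReg 0 0 = r.setReg 0 0 := by simp [State.setReg]
        rw [← ha]
        by_cases c1 : r.arr 17 (G.left d) = G.cornerColor val d <;>
          by_cases c2 : G.cornerColor val d = G.cornerColor val (rev d) <;>
          by_cases c3 : val d.1 = 0 <;>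
          simp only [checkStep, Code.eval, Expr.eval_dist, curEdge, Expr.eval, hr, f1, f2, f3, f4,
            f5, f6, c1, c2, c3, State.setReg_arr, State.setReg_reg, if_true, if_false, hr0,
            true_and, false_and, iff_self, iff_false, iff_true, not_true,
            OfNat.ofNat_ne_zero] <;> simp_all
      rw [heval]
      split
      · next hc =>
        refine ⟨hR.setReg (by simp) _, ha, ?_⟩
        rw [State.setReg_reg, if_neg (by simp), hI]
        exact ⟨fun hI => forall_dartCode_lt_succ hc hI, fun hI d' hd' => hI d' (by omega)⟩
      · next hc =>
        refine ⟨(hR.setReg (by simp) _).setReg (by simp) _, ha, ?_⟩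
        simp only [State.setReg_reg]
        refine ⟨fun h => by simp at h, fun hI => absurd (hI d (by omega)) hc⟩)
  refine ⟨key.2.1, key.2.2.trans ⟨fun h => ⟨fun d => (h d (dartCode_lt d)).1, fun d =>
    (h d (dartCode_lt d)).2⟩, fun h d _ => ⟨h.1 d, h.2 d⟩⟩⟩

theorem algorithm_countersSafe : algorithm.CountersSafe := by
  simp [algorithm, setupStep, partnerStep, deduceStep, colorStep, colorAt, checkStep,
    Code.CountersSafe, Code.Writes]

theorem algorithm_not_writes_one : ¬ algorithm.Writes 1 := by
  simp [algorithm, setupStep, partnerStep, deduceStep, colorStep, colorAt, checkStep,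
    Code.Writes]

theorem eval_algorithm (hG : G.IsPlane) (hdeg : G.MaxDegreeLE 3) :
    ∃ val : Fin m → ℕ, (∀ e : Fin m, (algorithm.eval G.input).arr 7 e = val e) ∧ G.Sound val ∧
      G.Stable val ∧
      ((algorithm.eval G.input).reg 0 ≠ 0 →
        (∃ c : Fin f → ℕ, ∀ d, c (G.left d) = G.cornerColor val d) ∧ G.ColorsMatch val) ∧
      ((∃ c : Fin f → ℕ, ∀ d, c (G.left d) = G.cornerColor val d) ∧ G.ColorsMatch val →
        (algorithm.eval G.input).reg 0 ≠ 0) := by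
  simp only [algorithm, Code.eval.eq_4]
  obtain ⟨h1, h2, h3⟩ := eval_setup G G.input rfl
  have hready : G.Ready (fun _ => 1) ((Code.count 3 setupStep).eval G.input) := ⟨h1, h2, h3⟩
  obtain ⟨hready, hp⟩ := hready.eval_partner
  obtain ⟨val, hready, hsound, hst⟩ := hready.eval_rounds hG hdeg hp
    (fun Z _ e => ⟨by simp, by simp, by simp⟩)
  obtain ⟨hready, h16, h17⟩ := hready.eval_color
  generalize (Code.count 3 colorStep).eval _ = s at *
  have hr : G.Ready val ((Code.assign 0 (.lit 1)).eval s) := hready.setReg (by simp) _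
  obtain ⟨h4, h5⟩ := hr.eval_check (by simp [Code.eval, Expr.eval]) h16
  refine ⟨val, ?_, hsound, hst, fun h => ?_, ?_⟩
  · rw [h4]; exact hr.val
  · obtain ⟨h6, h7⟩ := h5.1 h
    exact ⟨⟨fun x => s.arr 17 x, h6⟩, h7⟩
  · rintro ⟨⟨c, hc⟩, hm⟩
    exact h5.2 ⟨h17 c hc, hm⟩

end EmbeddedDigraph

/-! ### Assembly of the theorem. -/

theorem mainTheorem12 :
    ∃ (P : Ram.Prog) (p : Polynomial ℕ), ∀ (n m f : ℕ) (G : EmbeddedDigraph n m f),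
      G.IsPlane → G.MaxDegreeLE 3 →
      ∃ (t : ℕ) (s : Ram.State), Ram.Runs P G.input t s ∧ t ≤ p.eval (n + m) ∧
        -- the answer `0` reports that there is no Hamiltonian cycle
        ((s.reg 0 = 0 ∧ ∀ C : Set (Fin m), ¬ G.IsHamiltonianCycle C) ∨
        -- any other answer comes with the edge set of the spanning subgraph
         (s.reg 0 ≠ 0 ∧
          (∃ c : G.SubFace (EmbeddedDigraph.outputEdges m s) → FaceColor,
            G.IsOrientationColoring (EmbeddedDigraph.outputEdges m s) c) ∧
          ∀ C : Set (Fin m), G.IsHamiltonianCycle C →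
            C ⊆ EmbeddedDigraph.outputEdges m s)) := by
  refine ⟨Ram.HamiltonianReduction.algorithm.compile, Ram.HamiltonianReduction.algorithm.time, fun n m f G hG hdeg => ?_⟩
  obtain ⟨t, ht, htb⟩ := Ram.Code.runs_compile EmbeddedDigraph.algorithm_countersSafe EmbeddedDigraph.algorithm_not_writes_one
    G.input
  refine ⟨t, _, ht, htb.trans ?_, ?_⟩
  -- The running time is bounded by the polynomial at `m`; natural coefficients make it monotone.
  · rw [Polynomial.eval_eq_sum, Polynomial.eval_eq_sum]
    refine Finset.sum_le_sum fun i _ => Nat.mul_le_mul_left _ (Nat.pow_le_pow_left ?_ i)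
    exact Nat.le_add_left m n
  obtain ⟨val, hval, hsound, hst, h1, h2⟩ := EmbeddedDigraph.eval_algorithm hG hdeg
  have hout : EmbeddedDigraph.outputEdges m (Ram.HamiltonianReduction.algorithm.eval G.input) = {e | val e ≠ 0} := by
    ext e
    simp [EmbeddedDigraph.outputEdges, hval]
  by_cases h0 : (Ram.HamiltonianReduction.algorithm.eval G.input).reg 0 = 0
  · refine .inl ⟨h0, fun C hC => ?_⟩
    obtain ⟨Z, -, hZ⟩ := hC.exists_isTour
    exact h2 (hZ.exists_color hG hdeg (hsound Z hZ) hst) h0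
  · obtain ⟨⟨c, hc⟩, hm⟩ := h1 h0
    refine .inr ⟨h0, ?_, fun C hC e he => ?_⟩
    · rw [hout]
      exact hG.exists_isOrientationColoring hdeg hc hm
    · obtain ⟨Z, rfl, hZ⟩ := hC.exists_isTour
      rw [hout]
      exact fun h => (hsound Z hZ e).2.1 h he
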